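/- Let $N\ge 1$, let $\omega\in\mathbb{C}$ be a primitive $N$-th root of unity, and let $\mathbb{Z}_N=\mathbb{Z}/N\mathbb{Z}$. Let $z\in \mathrm{C}(\mathbb{Z}_N)$ be the function $z(t)=\omega^t$. **The algebra.** $\mathrm{C}(\mathrm{S}_N^+(\mathrm{R}))$ is the universal unital C*-algebra with generators $q_{ij}$, $i,j\in\mathbb{Z}_N$, and the relations, for all $i,j,k\in\mathbb{Z}_N$, (a) $q_{0i}=q_{i0}=\delta_{i0}1$; (b) $q_{ij}^*=\omega^{-i(i-j)}q_{-i,-j}$; (c) $q_{k,i+j}=\sum_{l\in\mathbb{Z}_N}\omega^{-l(i-k+l)}q_{k-l,i}q_{lj}$; (d) $q_{i+j,k}=\sum_{l\in\mathbb{Z}_N}\omega^{-i(l-j)}q_{jl}q_{i,k-l}$. It carries the $\mathbb{Z}_N$-action $\rho_t(q_{ij})=\omega^{t(j-i)}q_{ij}$, that is, the coaction of $\mathrm{C}(\mathbb{Z}_N)$ that sends $a$ to the function $t\mapsto\rho_t(a)$ in $\mathrm{C}(\mathbb{Z}_N,\mathrm{C}(\mathrm{S}_N^+(\mathrm{R})))$.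 **Braided tensor products.** Let $X,Y$ be unital C*-algebras with $\mathbb{Z}_N$-actions, represented faithfully and covariantly on Hilbert spaces $\mathcal{L}^X,\mathcal{L}^Y$ with unitary representations $\pi^X,\pi^Y$ of $\mathbb{Z}_N$. A vector $\xi$ has degree $m$ if $\pi(t)\xi=\omega^{tm}\xi$ for all $t$. Let $c:\mathcal{L}^X\otimes\mathcal{L}^Y\to\mathcal{L}^Y\otimes\mathcal{L}^X$ be the unitary with $c(\xi\otimes\eta)=\omega^{mn}\eta\otimes\xi$ for $\xi$ of degree $m$ and $\eta$ of degree $n$. Then $X\boxtimes_{\mathrm{R}}Y\subseteq\mathbb{B}(\mathcal{L}^X\otimes\mathcal{L}^Y)$ is the C*-algebra generated by the elements $j_1(x)j_2(y)$, $x\in X$, $y\in Y$, where $j_1(x)=x\otimes 1$ and $j_2(y)=c^{-1}(y\otimes 1)c$; it carries the $\mathbb{Z}_N$-action for which $j_1,j_2$ are equivariant. The algebra $\mathrm{C}(\mathbb{Z}_N)$, with the action $(\rho_tf)(s)=f(s+t)$, is represented on $\ell^2(\mathbb{Z}_N)$ by multiplication, and $\mathrm{C}(\mathrm{S}_N^+(\mathrm{R}))$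 on any Hilbert space $\mathcal{L}$ that carries a faithful covariant representation. **The bosonization.** There is a unique unital $*$-homomorphism $\Delta:\mathrm{C}(\mathrm{S}_N^+(\mathrm{R}))\to\mathrm{C}(\mathrm{S}_N^+(\mathrm{R}))\boxtimes_{\mathrm{R}}\mathrm{C}(\mathrm{S}_N^+(\mathrm{R}))$ with $\Delta(q_{ij})=\sum_k j_1(q_{ik})j_2(q_{kj})$. For $X=Y=\mathrm{C}(\mathrm{S}_N^+(\mathrm{R}))$ let $$\psi:\mathrm{C}(\mathbb{Z}_N)\boxtimes_{\mathrm{R}}X\boxtimes_{\mathrm{R}}Y\to(\mathrm{C}(\mathbb{Z}_N)\boxtimes_{\mathrm{R}}X)\otimes(\mathrm{C}(\mathbb{Z}_N)\boxtimes_{\mathrm{R}}Y)$$ (minimal tensor product on the right) be the unital $*$-homomorphism determined by $\psi(j_1(f))=(j_1\otimes j_1)(\Delta_{\mathbb{Z}_N}(f))$ with $\Delta_{\mathbb{Z}_N}(f)(s,t)=f(s+t)$, $\psi(j_2(a))=(j_2\otimes j_1)(\rho(a))=\sum_t j_2(\rho_t(a))\otimes j_1(\delta_t)$, and $\psi(j_3(b))=1\otimes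 j_2(b)$. The bosonization $\mathrm{S}_N^+(\mathrm{R})\rtimes\mathbb{Z}_N$ is the C*-algebra $\mathrm{C}(\mathrm{S}_N^+(\mathrm{R})\rtimes\mathbb{Z}_N)=\mathrm{C}(\mathbb{Z}_N)\boxtimes_{\mathrm{R}}\mathrm{C}(\mathrm{S}_N^+(\mathrm{R}))$ with the comultiplication $\Delta_{\rtimes}=\psi\circ(\mathrm{id}\boxtimes_{\mathrm{R}}\Delta)$, where $(\mathrm{id}\boxtimes_{\mathrm{R}}\Delta)(j_1(f)j_2(a))=j_1(f)j_2(\Delta(a))$; this comultiplication exists and is uniquely determined. **Theorem.** Write $z$ for $j_1(z)$ and $q_{ij}$ for $j_2(q_{ij})$. Then $\mathrm{C}(\mathrm{S}_N^+(\mathrm{R})\rtimes\mathbb{Z}_N)$ is the universal unital C*-algebra generated by $z$ and $q_{ij}$, $i,j\in\mathbb{Z}_N$, subject to (1) $zz^*=z^*z=1=z^N$; (2) $zq_{ij}=\omega^{j-i}q_{ij}z$ for all $i,j$; (3) the relations (a)-(d). That is, it is the crossed product of $\mathrm{C}(\mathrm{S}_N^+(\mathrm{R}))$ by the action $\rho$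 of $\mathbb{Z}_N$, where $z$ is the unitary that implements $\rho_1$. Furthermore, for all $i,j\in\mathbb{Z}_N$, $$\Delta_{\rtimes}(z)=z\otimes z,\qquad \Delta_{\rtimes}(q_{ij})=\sum_{k\in\mathbb{Z}_N}q_{ik}\otimes z^{k-i}q_{kj}.$$ -/

import Mathlib

open scoped TensorProduct ComplexOrder
open UniformSpace

universe u v w

namespace Anyonic

noncomputable section


/-! ## The free unital `*`-algebra -/

/-- The free unital complex `*`-algebra on a set `X`: the free algebra on letters `x` and `x^*`
(`Sum.inl x` and `Sum.inr x`), with the conjugate-linear antimultiplicative involution that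
exchanges `x` and `x^*`. -/
def FreeStar (X : Type u) : Type u := FreeAlgebra ℂ (X ⊕ X)

namespace FreeStar

variable {X : Type u}

instance : Ring (FreeStar X) := inferInstanceAs (Ring (FreeAlgebra ℂ (X ⊕ X)))
instance : Algebra ℂ (FreeStar X) := inferInstanceAs (Algebra ℂ (FreeAlgebra ℂ (X ⊕ X)))

/-- The opposite of the free algebra, with the conjugate scalar multiplication. -/
def ConjOp (X : Type u) : Type u := (FreeStar X)ᵐᵒᵖ

instance : Ring (ConjOp X) := inferInstanceAs (Ring (FreeStar X)ᵐᵒᵖ)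

instance : Algebra ℂ (ConjOp X) :=
  RingHom.toAlgebra' ((algebraMap ℂ (FreeStar X)ᵐᵒᵖ).comp (starRingEnd ℂ))
    (fun c x => Algebra.commutes (A := (FreeStar X)ᵐᵒᵖ) (starRingEnd ℂ c) x)

/-- The involution, as a homomorphism to the conjugate opposite algebra. -/
def starAux (X : Type u) : FreeAlgebra ℂ (X ⊕ X) →ₐ[ℂ] ConjOp X :=
  FreeAlgebra.lift ℂ (fun s => (MulOpposite.op (FreeAlgebra.ι ℂ s.swap : FreeStar X) : ConjOp X))

/-- The involution as a map. -/
def starFun (x : FreeStar X) : FreeStar X :=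
  MulOpposite.unop (starAux X x : (FreeStar X)ᵐᵒᵖ)

/-- The letter `x` or its adjoint, as an element of the free `*`-algebra. -/
def letter (s : X ⊕ X) : FreeStar X := FreeAlgebra.ι ℂ s

/-- The generator `x`. -/
def gen (x : X) : FreeStar X := letter (Sum.inl x)

theorem starFun_letter (s : X ⊕ X) : starFun (letter s) = letter s.swap :=
  congrArg MulOpposite.unop (FreeAlgebra.lift_ι_apply (A := ConjOp X) _ s)

theorem starFun_add (a b : FreeStar X) : starFun (a + b) = starFun a + starFun b :=
  congrArg MulOpposite.unop (map_add (starAux X) a b)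

theorem starFun_mul (a b : FreeStar X) : starFun (a * b) = starFun b * starFun a :=
  congrArg MulOpposite.unop (map_mul (starAux X) a b)

theorem starFun_algebraMap (c : ℂ) :
    starFun (algebraMap ℂ (FreeStar X) c) = algebraMap ℂ (FreeStar X) (starRingEnd ℂ c) :=
  congrArg MulOpposite.unop ((starAux X).commutes c)

theorem induction {P : FreeStar X → Prop} (h0 : ∀ c : ℂ, P (algebraMap ℂ (FreeStar X) c))
    (h1 : ∀ s, P (letter s)) (hm : ∀ a b, P a → P b → P (a * b))
    (ha : ∀ a b, P a → P b → P (a + b)) (x : FreeStar X) : P x :=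
  FreeAlgebra.induction ℂ (X ⊕ X) (motive := P) h0 h1 hm ha x

instance : StarRing (FreeStar X) where
  star := starFun
  star_involutive x := by
    induction x using FreeStar.induction with
    | h0 c => rw [starFun_algebraMap, starFun_algebraMap, Complex.conj_conj]
    | h1 s => rw [starFun_letter, starFun_letter, Sum.swap_swap]
    | hm a b ha hb => rw [starFun_mul, starFun_mul, ha, hb]
    | ha a b ha hb => rw [starFun_add, starFun_add, ha, hb]
  star_mul := starFun_mul
  star_add := starFun_add

theorem star_letter (s : X ⊕ X) : star (letter s) = letter s.swap := starFun_letter s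

theorem star_algebraMap' (c : ℂ) :
    star (algebraMap ℂ (FreeStar X) c) = algebraMap ℂ (FreeStar X) (starRingEnd ℂ c) :=
  starFun_algebraMap c

instance : StarModule ℂ (FreeStar X) where
  star_smul c x := by
    rw [Algebra.smul_def, star_mul, star_algebraMap', Algebra.smul_def]
    exact (Algebra.commutes _ _).symm

section lift

variable {B : Type v} [Ring B] [StarRing B] [Algebra ℂ B] [StarModule ℂ B]

/-- Evaluation of `*`-polynomials at a family of elements of a `*`-algebra. -/
def lift (f : X → B) : FreeStar X →⋆ₐ[ℂ] B :=
  { (FreeAlgebra.lift ℂ (Sum.elim f (fun x => star (f x))) : FreeAlgebra ℂ (X ⊕ X) →ₐ[ℂ] B) with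
    map_star' := by
      intro x
      set g : FreeStar X →ₐ[ℂ] B :=
        (FreeAlgebra.lift ℂ (Sum.elim f (fun x => star (f x))) : FreeAlgebra ℂ (X ⊕ X) →ₐ[ℂ] B)
      have hg : ∀ s, g (letter s) = Sum.elim f (fun x => star (f x)) s := fun s =>
        FreeAlgebra.lift_ι_apply _ s
      change g (star x) = star (g x)
      induction x using FreeStar.induction with
      | h0 c =>
        rw [star_algebraMap', AlgHom.commutes, AlgHom.commutes]
        exact algebraMap_star_comm c
      | h1 s => rw [star_letter, hg, hg]; cases s <;> simp
      | hm a b ha hb => simp [ha, hb]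
      | ha a b ha hb => simp [ha, hb] }

theorem lift_gen (f : X → B) (x : X) : lift f (gen x) = f x :=
  FreeAlgebra.lift_ι_apply _ (Sum.inl x)

end lift

end FreeStar

/-! ## C*-seminorms and their completions -/

/-- A C*-seminorm on a complex `*`-algebra. -/
structure CStarSeminorm (F : Type u) [Ring F] [StarRing F] [Algebra ℂ F] extends
    Seminorm ℂ F where
  mul_le' : ∀ x y, toFun (x * y) ≤ toFun x * toFun y
  star_mul_self' : ∀ x, toFun (star x * x) = toFun x * toFun x

namespace CStarSeminorm

variable {F : Type u} [Ring F] [StarRing F] [Algebra ℂ F] [StarModule ℂ F]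

instance : CoeFun (CStarSeminorm F) (fun _ => F → ℝ) := ⟨fun p => p.toFun⟩

variable (p : CStarSeminorm F)

theorem nonneg (x : F) : 0 ≤ p x := apply_nonneg p.toSeminorm x

theorem le_star (x : F) : p x ≤ p (star x) := by
  rcases (p.nonneg x).eq_or_lt with h | h
  · rw [← h]; exact p.nonneg _
  · have := p.mul_le' (star x) x
    rw [p.star_mul_self'] at this
    exact le_of_mul_le_mul_right this h

theorem map_star (x : F) : p (star x) = p x :=
  le_antisymm (by simpa using p.le_star (star x)) (p.le_star x)

/-- The algebra `F`, to be equipped with the C*-seminorm `p`. -/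
@[nolint unusedArguments]
def Carrier (_ : CStarSeminorm F) : Type u := F

instance : Ring p.Carrier := inferInstanceAs (Ring F)
instance : StarRing p.Carrier := inferInstanceAs (StarRing F)
instance : Algebra ℂ p.Carrier := inferInstanceAs (Algebra ℂ F)
instance : StarModule ℂ p.Carrier := inferInstanceAs (StarModule ℂ F)

instance : Norm p.Carrier := ⟨fun x => p x⟩

instance : SeminormedAddCommGroup p.Carrier :=
  SeminormedAddCommGroup.ofCore (𝕜 := ℂ)
    { norm_nonneg := p.nonneg
      norm_smul := p.toSeminorm.smul'
      norm_triangle := p.toSeminorm.add_le' }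

instance : SeminormedRing p.Carrier :=
  { (inferInstance : SeminormedAddCommGroup p.Carrier), (inferInstance : Ring p.Carrier) with
    norm_mul_le := p.mul_le' }

instance : NormedAlgebra ℂ p.Carrier where
  __ := (inferInstance : Algebra ℂ p.Carrier)
  norm_smul_le c x := (p.toSeminorm.smul' c x).le

instance : NormedStarGroup p.Carrier where
  norm_star_le x := (p.map_star x).le

/-- The Hausdorff completion of `F` with respect to the C*-seminorm `p`. -/
def Compl : Type u := Completion p.Carrier

instance : NormedRing p.Compl := inferInstanceAs (NormedRing (Completion p.Carrier))
instance : CompleteSpace p.Compl := inferInstanceAs (CompleteSpace (Completion p.Carrier))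
instance : NormedAlgebra ℂ p.Compl where
  __ := (inferInstance : Algebra ℂ (Completion p.Carrier))
  norm_smul_le c x := norm_smul_le (β := Completion p.Carrier) c x

/-- The canonical map to the completion. -/
def coe (x : F) : p.Compl := Completion.coe' (α := p.Carrier) x

theorem norm_coe (x : F) : ‖p.coe x‖ = p x := Completion.norm_coe (E := p.Carrier) x

theorem coe_add (x y : F) : p.coe (x + y) = p.coe x + p.coe y :=
  Completion.coe_add (α := p.Carrier) x y

theorem coe_mul (x y : F) : p.coe (x * y) = p.coe x * p.coe y :=
  Completion.coe_mul (α := p.Carrier) x y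

theorem coe_algebraMap (c : ℂ) : p.coe (algebraMap ℂ F c) = algebraMap ℂ p.Compl c := rfl

theorem isometry_coe : Isometry (fun x : p.Carrier => p.coe x) := Completion.coe_isometry

theorem denseRange_coe : DenseRange (fun x : p.Carrier => p.coe x) := Completion.denseRange_coe

theorem induction {P : p.Compl → Prop} (x : p.Compl) (hc : IsClosed {x | P x})
    (h : ∀ a : F, P (p.coe a)) : P x :=
  Completion.induction_on (α := p.Carrier) x hc h

instance : Star p.Compl := ⟨Completion.map (fun x : p.Carrier => star x)⟩

theorem coe_star (x : F) : p.coe (star x) = star (p.coe x) :=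
  (Completion.map_coe (α := p.Carrier) (β := p.Carrier)
    (starₗᵢ ℂ : p.Carrier ≃ₗᵢ⋆[ℂ] p.Carrier).isometry.uniformContinuous x).symm

instance : ContinuousStar p.Compl := ⟨Completion.continuous_map⟩

instance : StarRing p.Compl where
  star_involutive x := by
    induction x using p.induction with
    | hc => exact isClosed_eq (by fun_prop) (by fun_prop)
    | h a => rw [← coe_star, ← coe_star, star_star]
  star_mul x y := by
    induction x using p.induction with
    | hc => exact isClosed_eq (by fun_prop) (by fun_prop)
    | h a =>
      induction y using p.induction with
      | hc => exact isClosed_eq (by fun_prop) (by fun_prop)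
      | h b => rw [← coe_mul, ← coe_star, ← coe_star, ← coe_star, star_mul, coe_mul]
  star_add x y := by
    induction x using p.induction with
    | hc => exact isClosed_eq (by fun_prop) (by fun_prop)
    | h a =>
      induction y using p.induction with
      | hc => exact isClosed_eq (by fun_prop) (by fun_prop)
      | h b => rw [← coe_add, ← coe_star, ← coe_star, ← coe_star, star_add, coe_add]

theorem coe_smul (c : ℂ) (x : F) : p.coe (c • x) = c • p.coe x := by
  rw [Algebra.smul_def, coe_mul, coe_algebraMap, Algebra.smul_def]

instance : CStarRing p.Compl where
  norm_mul_self_le x := by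
    induction x using p.induction with
    | hc =>
      exact isClosed_le (continuous_norm.mul continuous_norm)
        (continuous_norm.comp (continuous_star.mul continuous_id))
    | h a => rw [← coe_star, ← coe_mul, norm_coe, norm_coe, p.star_mul_self']

instance : StarModule ℂ p.Compl where
  star_smul c x := by
    induction x using p.induction with
    | hc =>
      exact isClosed_eq (continuous_star.comp (continuous_const_smul c))
        ((continuous_const_smul _).comp continuous_star)
    | h a => rw [← coe_smul, ← coe_star, ← coe_star, ← coe_smul, star_smul]

instance : CStarAlgebra p.Compl where

/-- The canonical `*`-homomorphism to the completion. -/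
def toCompl : F →⋆ₐ[ℂ] p.Compl where
  toFun := p.coe
  map_one' := rfl
  map_mul' := p.coe_mul
  map_zero' := rfl
  map_add' := p.coe_add
  commutes' := p.coe_algebraMap
  map_star' := p.coe_star

theorem norm_toCompl (x : F) : ‖p.toCompl x‖ = p x := p.norm_coe x

theorem denseRange_toCompl : DenseRange p.toCompl := p.denseRange_coe

section lift

variable {p} {B : Type v} [CStarAlgebra B] (φ : F →⋆ₐ[ℂ] B) (h : ∀ x, ‖φ x‖ ≤ p x)

theorem lipschitz_aux (h : ∀ x, ‖φ x‖ ≤ p x) : LipschitzWith 1 (fun x : p.Carrier => φ x) :=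
  LipschitzWith.of_dist_le_mul fun x y => by
    rw [NNReal.coe_one, one_mul, dist_eq_norm, dist_eq_norm]
    exact (map_sub φ (x : F) y) ▸ h (x - y : F)

/-- The extension of a `*`-homomorphism dominated by `p` to the completion, as a map. -/
def liftFun : p.Compl → B := Completion.extension (fun x : p.Carrier => φ x)

theorem continuous_liftFun : Continuous (liftFun (p := p) φ) := Completion.continuous_extension

theorem liftFun_coe (h : ∀ x, ‖φ x‖ ≤ p x) (x : F) : liftFun φ (p.coe x) = φ x :=
  Completion.extension_coe (lipschitz_aux φ h).uniformContinuous x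

/-- The extension of a `*`-homomorphism dominated by `p` to the completion. -/
def lift : p.Compl →⋆ₐ[ℂ] B where
  toFun := liftFun φ
  map_one' := (liftFun_coe φ h 1).trans (map_one φ)
  map_zero' := (liftFun_coe φ h 0).trans (map_zero φ)
  commutes' c := (liftFun_coe φ h (algebraMap ℂ F c)).trans (AlgHomClass.commutes φ c)
  map_mul' x y := by
    have := continuous_liftFun (p := p) φ
    induction x using p.induction with
    | hc => exact isClosed_eq (by fun_prop) (by fun_prop)
    | h a =>
      induction y using p.induction with
      | hc => exact isClosed_eq (by fun_prop) (by fun_prop)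
      | h b => rw [← coe_mul, liftFun_coe φ h, liftFun_coe φ h, liftFun_coe φ h, map_mul]
  map_add' x y := by
    have := continuous_liftFun (p := p) φ
    induction x using p.induction with
    | hc => exact isClosed_eq (by fun_prop) (by fun_prop)
    | h a =>
      induction y using p.induction with
      | hc => exact isClosed_eq (by fun_prop) (by fun_prop)
      | h b => rw [← coe_add, liftFun_coe φ h, liftFun_coe φ h, liftFun_coe φ h, map_add]
  map_star' x := by
    have := continuous_liftFun (p := p) φ
    induction x using p.induction with
    | hc => exact isClosed_eq (by fun_prop) (by fun_prop)
    | h a => rw [← coe_star, liftFun_coe φ h, liftFun_coe φ h, StarHomClass.map_star φ]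

theorem lift_toCompl (x : F) : lift φ h (p.toCompl x) = φ x := liftFun_coe φ h x

end lift

/-- The C*-seminorm obtained from a `*`-homomorphism to a C*-algebra. -/
def ofHom {B : Type v} [CStarAlgebra B] (φ : F →⋆ₐ[ℂ] B) : CStarSeminorm F where
  toFun x := ‖φ x‖
  map_zero' := by simp
  add_le' x y := by rw [map_add]; exact norm_add_le _ _
  neg' x := by simp
  smul' c x := by rw [map_smul, norm_smul]
  mul_le' x y := by rw [map_mul]; exact norm_mul_le _ _
  star_mul_self' x := by rw [map_mul, StarHomClass.map_star, CStarRing.norm_star_mul_self]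

/-- The C*-seminorms that vanish on a set of relators. -/
def Kills (S : Set F) (p : CStarSeminorm F) : Prop := ∀ r ∈ S, p r = 0

/-- The largest C*-seminorm that vanishes on a set of relators, when it is finite. -/
def largest (S : Set F)
    (hS : ∀ x, BddAbove (Set.range fun p : {p : CStarSeminorm F // p.Kills S} => p.1 x)) :
    CStarSeminorm F :=
  haveI : Nonempty {p : CStarSeminorm F // p.Kills S} :=
    ⟨⟨⟨0, fun _ _ => (zero_mul (0 : ℝ)).ge, fun _ => (zero_mul (0 : ℝ)).symm⟩, fun _ _ => rfl⟩⟩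
  { toFun x := ⨆ p : {p : CStarSeminorm F // p.Kills S}, p.1 x
    map_zero' := (iSup_congr fun p => p.1.map_zero').trans ciSup_const
    add_le' x y := ciSup_le fun p => (p.1.add_le' x y).trans
      (add_le_add (le_ciSup (hS x) p) (le_ciSup (hS y) p))
    neg' x := iSup_congr fun p => p.1.neg' x
    smul' c x := by
      rw [Real.mul_iSup_of_nonneg (norm_nonneg c)]
      exact iSup_congr fun p => p.1.smul' c x
    mul_le' x y := ciSup_le fun p => (p.1.mul_le' x y).trans
      (mul_le_mul (le_ciSup (hS x) p) (le_ciSup (hS y) p) (p.1.nonneg y)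
        (Real.iSup_nonneg fun p => p.1.nonneg x))
    star_mul_self' x := by
      apply le_antisymm
      · refine ciSup_le fun p => ?_
        rw [p.1.star_mul_self']
        exact mul_le_mul (le_ciSup (hS x) p) (le_ciSup (hS x) p) (p.1.nonneg x)
          (Real.iSup_nonneg fun p => p.1.nonneg x)
      · have h0 : 0 ≤ ⨆ p : {p : CStarSeminorm F // p.Kills S}, p.1 (star x * x) :=
          Real.iSup_nonneg fun p => p.1.nonneg _
        have h1 : (⨆ p : {p : CStarSeminorm F // p.Kills S}, p.1 x) ≤
            √(⨆ p : {p : CStarSeminorm F // p.Kills S}, p.1 (star x * x)) :=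
          ciSup_le fun p => Real.le_sqrt_of_sq_le <| by
            rw [sq, ← p.1.star_mul_self']
            exact le_ciSup (hS (star x * x)) p
        rw [← Real.mul_self_sqrt h0]
        exact mul_self_le_mul_self (Real.iSup_nonneg fun p => p.1.nonneg x) h1 }

theorem le_largest (S : Set F)
    (hS : ∀ x, BddAbove (Set.range fun p : {p : CStarSeminorm F // p.Kills S} => p.1 x))
    (p : CStarSeminorm F) (hp : p.Kills S) (x : F) : p x ≤ largest S hS x :=
  le_ciSup (hS x) ⟨p, hp⟩

theorem largest_kills (S : Set F)
    (hS : ∀ x, BddAbove (Set.range fun p : {p : CStarSeminorm F // p.Kills S} => p.1 x)) :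
    (largest S hS).Kills S := fun r hr =>
  haveI : Nonempty {p : CStarSeminorm F // p.Kills S} :=
    ⟨⟨⟨0, fun _ _ => (zero_mul (0 : ℝ)).ge, fun _ => (zero_mul (0 : ℝ)).symm⟩, fun _ _ => rfl⟩⟩
  (iSup_congr fun p => p.2 r hr).trans ciSup_const

end CStarSeminorm

/-! ## The algebra of functions on the anyonic quantum permutation group -/

section Perm

variable {N : ℕ} [NeZero N]

/-- The power `ω ^ k` of an `N`-th root of unity `ω`, for an exponent `k ∈ ℤ/Nℤ`. -/
def rpow (ω : ℂ) (k : ZMod N) : ℂ := ω ^ k.val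

/-- The defining relations of `C(S_N^+(R))`, for elements `q i j` of a unital `*`-algebra. -/
structure PermRel (ω : ℂ) {B : Type v} [Ring B] [StarRing B] [Algebra ℂ B]
    (q : ZMod N → ZMod N → B) : Prop where
  row_zero : ∀ i, q 0 i = if i = 0 then 1 else 0
  col_zero : ∀ i, q i 0 = if i = 0 then 1 else 0
  star_eq : ∀ i j, star (q i j) = rpow ω (-(i * (i - j))) • q (-i) (-j)
  mul_col : ∀ i j k,
    q k (i + j) = ∑ l, rpow ω (-(l * (i - k + l))) • (q (k - l) i * q l j)
  mul_row : ∀ i j k,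
    q (i + j) k = ∑ l, rpow ω (-(i * (l - j))) • (q j l * q i (k - l))

/-- The free unital `*`-algebra on letters `q i j` for `i, j ∈ ℤ/Nℤ`. -/
abbrev PermFree (N : ℕ) : Type := FreeStar (ZMod N × ZMod N)

/-- The letter `q i j`. -/
abbrev letterQ (i j : ZMod N) : PermFree N := FreeStar.gen (i, j)

/-- The defining relations of `C(S_N^+(R))`, as elements of the free `*`-algebra. -/
inductive PermRelator (ω : ℂ) : PermFree N → Prop
  | row_zero (i : ZMod N) : PermRelator ω (letterQ 0 i - if i = 0 then 1 else 0)
  | col_zero (i : ZMod N) : PermRelator ω (letterQ i 0 - if i = 0 then 1 else 0)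
  | star_eq (i j : ZMod N) :
      PermRelator ω (star (letterQ i j) - rpow ω (-(i * (i - j))) • letterQ (-i) (-j))
  | mul_col (i j k : ZMod N) :
      PermRelator ω (letterQ k (i + j) -
        ∑ l, rpow ω (-(l * (i - k + l))) • (letterQ (k - l) i * letterQ l j))
  | mul_row (i j k : ZMod N) :
      PermRelator ω (letterQ (i + j) k -
        ∑ l, rpow ω (-(i * (l - j))) • (letterQ j l * letterQ i (k - l)))

theorem permRel_of_kills (ω : ℂ) {B : Type v} [Ring B] [StarRing B] [Algebra ℂ B]
    (φ : PermFree N →⋆ₐ[ℂ] B) (h : ∀ r, PermRelator ω r → φ r = 0) :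
    PermRel ω (fun i j => φ (letterQ i j)) where
  row_zero i := by
    have := h _ (.row_zero i)
    rw [map_sub, sub_eq_zero] at this
    rw [this]; split_ifs <;> simp
  col_zero i := by
    have := h _ (.col_zero i)
    rw [map_sub, sub_eq_zero] at this
    rw [this]; split_ifs <;> simp
  star_eq i j := by
    have := h _ (.star_eq i j)
    rw [map_sub, sub_eq_zero, map_star, map_smul] at this
    exact this
  mul_col i j k := by
    have := h _ (.mul_col i j k)
    rw [map_sub, sub_eq_zero] at this
    simpa using this
  mul_row i j k := by
    have := h _ (.mul_row i j k)
    rw [map_sub, sub_eq_zero] at this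
    simpa using this

theorem kills_of_permRel (ω : ℂ) {B : Type v} [Ring B] [StarRing B] [Algebra ℂ B]
    (φ : PermFree N →⋆ₐ[ℂ] B) (h : PermRel ω (fun i j => φ (letterQ i j))) (r : PermFree N)
    (hr : PermRelator ω r) : φ r = 0 := by
  cases hr with
  | row_zero i =>
    rw [map_sub, sub_eq_zero, h.row_zero i]; split_ifs <;> simp
  | col_zero i =>
    rw [map_sub, sub_eq_zero, h.col_zero i]; split_ifs <;> simp
  | star_eq i j =>
    rw [map_sub, sub_eq_zero, map_star, map_smul]; exact h.star_eq i j
  | mul_col i j k =>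
    rw [map_sub, sub_eq_zero]; simpa using h.mul_col i j k
  | mul_row i j k =>
    rw [map_sub, sub_eq_zero]; simpa using h.mul_row i j k

theorem continuous_hom {A : Type u} {B : Type v} [CStarAlgebra A] [CStarAlgebra B]
    (φ : A →⋆ₐ[ℂ] B) : Continuous φ :=
  AddMonoidHomClass.continuous_of_bound φ 1 fun x => by
    simpa using NonUnitalStarAlgHom.norm_apply_le φ x

theorem norm_le_one_of_sum {B : Type v} [CStarAlgebra B] {ι : Type*} [Fintype ι] (a : ι → B)
    (h : ∑ l, star (a l) * a l = 1) (l : ι) : ‖a l‖ ≤ 1 := by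
  let _ := CStarAlgebra.spectralOrder B
  have _ := CStarAlgebra.spectralOrderedRing B
  have h1 : star (a l) * a l ≤ 1 := by
    rw [← h]
    exact Finset.single_le_sum (f := fun l => star (a l) * a l)
      (fun i _ => star_mul_self_nonneg (a i)) (Finset.mem_univ l)
  have h2 := (CStarAlgebra.norm_le_one_iff_of_nonneg _ (star_mul_self_nonneg (a l))).2 h1
  rw [CStarRing.norm_star_mul_self] at h2
  nlinarith [norm_nonneg (a l)]

theorem PermRel.norm_le_one {ω : ℂ} {B : Type v} [CStarAlgebra B]
    {q : ZMod N → ZMod N → B} (h : PermRel ω q) (i j : ZMod N) : ‖q i j‖ ≤ 1 := by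
  refine norm_le_one_of_sum (fun l => q l j) ?_ i
  have h1 := h.mul_col (-j) j 0
  rw [neg_add_cancel, h.row_zero 0, if_pos rfl] at h1
  rw [h1]
  refine Finset.sum_congr rfl fun l _ => ?_
  rw [h.star_eq, smul_mul_assoc, zero_sub]
  congr 2; ring

theorem perm_bddAbove (ω : ℂ) (x : PermFree N) :
    BddAbove (Set.range fun p : {p : CStarSeminorm (PermFree N) //
      p.Kills {r | PermRelator ω r}} => p.1 x) := by
  suffices H : ∃ M, ∀ p : CStarSeminorm (PermFree N), p.Kills {r | PermRelator ω r} → p x ≤ M by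
    obtain ⟨M, hM⟩ := H
    exact ⟨M, by rintro _ ⟨p, rfl⟩; exact hM p.1 p.2⟩
  induction x using FreeStar.induction with
  | h0 c =>
    refine ⟨‖c‖, fun p _ => ?_⟩
    have h1 : p (1 : PermFree N) ≤ 1 := by
      have := p.star_mul_self' 1
      rw [star_one, mul_one] at this
      nlinarith [p.nonneg 1]
    rw [Algebra.algebraMap_eq_smul_one]
    exact (p.smul' c 1).trans_le (mul_le_of_le_one_right (norm_nonneg c) h1)
  | h1 s =>
    refine ⟨1, fun p hp => ?_⟩
    have h : ∀ i j, p (letterQ i j) ≤ 1 := fun i j => by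
      rw [← p.norm_toCompl]
      refine (permRel_of_kills ω p.toCompl fun r hr => ?_).norm_le_one i j
      rw [← norm_eq_zero, p.norm_toCompl]
      exact hp r hr
    rcases s with ⟨i, j⟩ | ⟨i, j⟩
    · exact h i j
    · have : (FreeStar.letter (Sum.inr (i, j)) : PermFree N) = star (letterQ i j) :=
        (FreeStar.star_letter (Sum.inl (i, j))).symm
      rw [this, p.map_star]
      exact h i j
  | hm a b ha hb =>
    obtain ⟨M, hM⟩ := ha
    obtain ⟨M', hM'⟩ := hb
    exact ⟨M * M', fun p hp => (p.mul_le' a b).trans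
      (mul_le_mul (hM p hp) (hM' p hp) (p.nonneg b) ((p.nonneg a).trans (hM p hp)))⟩
  | ha a b ha hb =>
    obtain ⟨M, hM⟩ := ha
    obtain ⟨M', hM'⟩ := hb
    exact ⟨M + M', fun p hp => (p.add_le' a b).trans (add_le_add (hM p hp) (hM' p hp))⟩

/-- The largest C*-seminorm on the universal unital `*`-algebra with generators `q i j` and the
relations `PermRel`, that is, the largest C*-seminorm on the free `*`-algebra that vanishes on the
relations. -/
def permSeminorm (ω : ℂ) : CStarSeminorm (PermFree N) :=
  CStarSeminorm.largest {r | PermRelator ω r} (perm_bddAbove ω)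

variable (N) in
/-- The universal unital C*-algebra `C(S_N^+(R))` with generators `q i j` for `i, j ∈ ℤ/Nℤ` and the
relations `PermRel`. -/
abbrev CPerm (ω : ℂ) : Type := (permSeminorm (N := N) ω).Compl

namespace CPerm

variable {ω : ℂ}

/-- The generators of `C(S_N^+(R))`. -/
def q (ω : ℂ) (i j : ZMod N) : CPerm N ω := (permSeminorm ω).toCompl (letterQ i j)

theorem rel (ω : ℂ) : PermRel (N := N) ω (q ω) :=
  permRel_of_kills ω (permSeminorm ω).toCompl fun r hr => by
    rw [← norm_eq_zero, CStarSeminorm.norm_toCompl]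
    exact CStarSeminorm.largest_kills _ (perm_bddAbove ω) r hr

section lift

variable {B : Type v} [CStarAlgebra B] {b : ZMod N → ZMod N → B}

/-- The universal property of `C(S_N^+(R))`. -/
def lift (h : PermRel ω b) : CPerm N ω →⋆ₐ[ℂ] B :=
  CStarSeminorm.lift (p := permSeminorm ω)
    (FreeStar.lift (fun x : ZMod N × ZMod N => b x.1 x.2))
    (fun x => CStarSeminorm.le_largest _ (perm_bddAbove ω)
      (CStarSeminorm.ofHom (FreeStar.lift (fun x : ZMod N × ZMod N => b x.1 x.2)))
      (fun r hr => norm_eq_zero.2 <| kills_of_permRel ω _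
        (by simpa only [letterQ, FreeStar.lift_gen] using h) r hr) x)

theorem lift_q (h : PermRel ω b) (i j : ZMod N) : lift h (q ω i j) = b i j :=
  (CStarSeminorm.lift_toCompl _ _ _).trans (FreeStar.lift_gen _ _)

theorem hom_ext {φ ψ : CPerm N ω →⋆ₐ[ℂ] B} (h : ∀ i j, φ (q ω i j) = ψ (q ω i j)) : φ = ψ := by
  have hφ : Continuous φ := continuous_hom φ
  have hψ : Continuous ψ := continuous_hom ψ
  refine StarAlgHom.ext fun x => congrFun ((permSeminorm ω).denseRange_toCompl.equalizer hφ hψ ?_) x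
  funext x
  change φ ((permSeminorm ω).toCompl x) = ψ ((permSeminorm ω).toCompl x)
  induction x using FreeStar.induction with
  | h0 c => simp only [AlgHomClass.commutes]
  | h1 s =>
    rcases s with ⟨i, j⟩ | ⟨i, j⟩
    · exact h i j
    · have : (FreeStar.letter (Sum.inr (i, j)) : PermFree N) = star (letterQ i j) :=
        (FreeStar.star_letter (Sum.inl (i, j))).symm
      rw [this, map_star, map_star, map_star]
      exact congrArg star (h i j)
  | hm a b ha hb => simp only [map_mul, ha, hb]
  | ha a b ha hb => simp only [map_add, ha, hb]

end lift

end CPerm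

end Perm

/-! ## `ℤ/Nℤ`-C*-algebras and their covariant representations -/

/-- The structure of a `ℤ/Nℤ`-C*-algebra on a unital C*-algebra `A`. Under
`A ⊗ C(ℤ/Nℤ) = C(ℤ/Nℤ, A)` the coaction is `a ↦ (t ↦ ρ t a)`; its coassociativity is `ρ_add`, and,
given this, the density of `ρ(A)(1 ⊗ C(ℤ/Nℤ))` is `ρ_zero`. -/
structure ZNAction (N : ℕ) (A : Type u) [CStarAlgebra A] where
  ρ : ZMod N → (A →⋆ₐ[ℂ] A)
  ρ_zero : ∀ a, ρ 0 a = a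
  ρ_add : ∀ s t a, ρ (s + t) a = ρ s (ρ t a)

/-- A faithful `ℤ/Nℤ`-equivariant representation of a `ℤ/Nℤ`-C*-algebra on a Hilbert space with a
unitary representation of `ℤ/Nℤ`. -/
structure CovRep {N : ℕ} {A : Type u} [CStarAlgebra A] (α : ZNAction N A)
    (H : Type v) [NormedAddCommGroup H] [InnerProductSpace ℂ H] [CompleteSpace H] where
  U : Multiplicative (ZMod N) →* unitary (H →L[ℂ] H)
  π : A →⋆ₐ[ℂ] (H →L[ℂ] H)
  faithful : Function.Injective π
  covariant : ∀ (t : ZMod N) (a : A),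
    π (α.ρ t a) = U (.ofAdd t) * π a * star (U (.ofAdd t) : H →L[ℂ] H)

section Roots

variable {N : ℕ} [NeZero N] {ω : ℂ}

theorem rpow_natCast (hω : IsPrimitiveRoot ω N) (n : ℕ) : rpow ω (n : ZMod N) = ω ^ n := by
  rw [rpow, ZMod.val_natCast]
  exact (pow_eq_pow_mod n hω.pow_eq_one).symm

theorem rpow_zero : rpow ω (0 : ZMod N) = 1 := by simp [rpow]

theorem rpow_add (hω : IsPrimitiveRoot ω N) (a b : ZMod N) :
    rpow ω (a + b) = rpow ω a * rpow ω b := by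
  rw [← ZMod.natCast_zmod_val a, ← ZMod.natCast_zmod_val b, ← Nat.cast_add, rpow_natCast hω,
    rpow_natCast hω, rpow_natCast hω, pow_add]

theorem rpow_mul_neg (hω : IsPrimitiveRoot ω N) (a : ZMod N) : rpow ω a * rpow ω (-a) = 1 := by
  rw [← rpow_add hω, add_neg_cancel, rpow_zero]

theorem rpow_neg_mul (hω : IsPrimitiveRoot ω N) (a : ZMod N) : rpow ω (-a) * rpow ω a = 1 := by
  rw [mul_comm, rpow_mul_neg hω]

theorem star_rpow (hω : IsPrimitiveRoot ω N) (a : ZMod N) : star (rpow ω a) = rpow ω (-a) := by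
  have h : ‖rpow ω a‖ = 1 := by
    rw [rpow, norm_pow, hω.norm'_eq_one (NeZero.ne N), one_pow]
  have h1 : rpow ω a * star (rpow ω a) = 1 := by
    rw [Complex.star_def, Complex.mul_conj, Complex.normSq_eq_norm_sq, h]; simp
  have h0 : rpow ω a ≠ 0 := fun h' => by simp [h'] at h1
  exact mul_left_cancel₀ h0 (h1.trans (rpow_mul_neg hω a).symm)

theorem sum_rpow (hω : IsPrimitiveRoot ω N) (m : ZMod N) :
    ∑ t : ZMod N, rpow ω (t * m) = if m = 0 then (N : ℂ) else 0 := by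
  split_ifs with hm
  · simp [hm, rpow_zero]
  · have h1 : rpow ω m ≠ 1 := fun h => hm <| by
      have := (hω.pow_eq_one_iff_dvd m.val).1 h
      rw [← ZMod.natCast_zmod_val m]
      exact (ZMod.natCast_eq_zero_iff _ _).2 this
    have h2 : rpow ω m * ∑ t : ZMod N, rpow ω (t * m) = ∑ t : ZMod N, rpow ω (t * m) := by
      rw [Finset.mul_sum]
      refine Fintype.sum_equiv (Equiv.addRight (1 : ZMod N)) _ _ fun t => ?_
      rw [← rpow_add hω]; congr 1
      simp only [Equiv.coe_addRight]; ring
    have h3 : (rpow ω m - 1) * ∑ t : ZMod N, rpow ω (t * m) = 0 := by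
      rw [sub_mul, h2, one_mul, sub_self]
    exact (mul_eq_zero.1 h3).resolve_left (sub_ne_zero.2 h1)

end Roots

/-! ## Hilbert space tensor products -/

section Hilbert

variable {H : Type u} [NormedAddCommGroup H] [InnerProductSpace ℂ H]
variable {K : Type v} [NormedAddCommGroup K] [InnerProductSpace ℂ K]
variable {H' : Type*} [NormedAddCommGroup H'] [InnerProductSpace ℂ H']
variable {K' : Type*} [NormedAddCommGroup K'] [InnerProductSpace ℂ K']

variable (H K) in
/-- The tensor product of Hilbert spaces. -/
def HTensor : Type (max u v) := Completion (H ⊗[ℂ] K)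

instance : NormedAddCommGroup (HTensor H K) :=
  inferInstanceAs (NormedAddCommGroup (Completion (H ⊗[ℂ] K)))

instance : InnerProductSpace ℂ (HTensor H K) :=
  inferInstanceAs (InnerProductSpace ℂ (Completion (H ⊗[ℂ] K)))

instance : CompleteSpace (HTensor H K) :=
  inferInstanceAs (CompleteSpace (Completion (H ⊗[ℂ] K)))

/-- The embedding of the algebraic tensor product. -/
def coeT : H ⊗[ℂ] K →L[ℂ] HTensor H K :=
  (Completion.toComplL : H ⊗[ℂ] K →L[ℂ] Completion (H ⊗[ℂ] K))

/-- An elementary tensor. -/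
def elem (h : H) (k : K) : HTensor H K := coeT (h ⊗ₜ[ℂ] k)

/-- The extension of a bounded operator to the completed tensor products. -/
def extT (T : H ⊗[ℂ] K →L[ℂ] H' ⊗[ℂ] K') : HTensor H K →L[ℂ] HTensor H' K' :=
  (T.completion : Completion (H ⊗[ℂ] K) →L[ℂ] Completion (H' ⊗[ℂ] K'))

/-- The tensor product of bounded operators. -/
def opT (S : H →L[ℂ] H') (T : K →L[ℂ] K') : HTensor H K →L[ℂ] HTensor H' K' :=
  extT (TensorProduct.mapL S T)

variable (H K) in
/-- The flip `h ⊗ k ↦ k ⊗ h`. -/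
def flipT : HTensor H K →L[ℂ] HTensor K H :=
  extT ((TensorProduct.commIsometry ℂ H K).toContinuousLinearEquiv : H ⊗[ℂ] K →L[ℂ] K ⊗[ℂ] H)

theorem extT_coeT (T : H ⊗[ℂ] K →L[ℂ] H' ⊗[ℂ] K') (x : H ⊗[ℂ] K) :
    extT T (coeT x) = coeT (T x) :=
  ContinuousLinearMap.completion_apply_coe T x

theorem inner_coeT (x y : H ⊗[ℂ] K) : inner ℂ (coeT x) (coeT y) = inner ℂ x y :=
  Completion.inner_coe x y

theorem induction_coeT {P : HTensor H K → Prop} (x : HTensor H K) (hP : IsClosed {x | P x})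
    (h : ∀ x : H ⊗[ℂ] K, P (coeT x)) : P x :=
  Completion.induction_on (α := H ⊗[ℂ] K) x hP h

theorem opT_elem (S : H →L[ℂ] H') (T : K →L[ℂ] K') (h : H) (k : K) :
    opT S T (elem h k) = elem (S h) (T k) := by
  rw [opT, elem, extT_coeT, elem]; simp

theorem flipT_elem (h : H) (k : K) : flipT H K (elem h k) = elem k h := by
  rw [flipT, elem, extT_coeT, elem]; simp

theorem inner_elem (h h' : H) (k k' : K) :
    inner ℂ (elem h k) (elem h' k') = inner ℂ h h' * inner ℂ k k' := by
  rw [elem, elem, inner_coeT]; simp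

theorem ext_elem {E : Type w} [NormedAddCommGroup E] [NormedSpace ℂ E]
    {S T : HTensor H K →L[ℂ] E} (h : ∀ a b, S (elem a b) = T (elem a b)) : S = T := by
  refine ContinuousLinearMap.ext fun x => ?_
  induction x using induction_coeT with
  | hP => exact isClosed_eq S.continuous T.continuous
  | h x =>
    induction x using TensorProduct.induction_on with
    | zero => rw [map_zero, map_zero, map_zero]
    | tmul a b => exact h a b
    | add x y hx hy => rw [map_add, map_add, map_add, hx, hy]

theorem opT_mul (S S' : H →L[ℂ] H) (T T' : K →L[ℂ] K) :
    opT S T * opT S' T' = opT (S * S') (T * T') :=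
  ext_elem fun a b => by simp [opT_elem]

theorem opT_one : opT (1 : H →L[ℂ] H) (1 : K →L[ℂ] K) = 1 :=
  ext_elem fun a b => by simp [opT_elem]

theorem elem_add_left (a a' : H) (b : K) : elem (a + a') b = elem a b + elem a' b := by
  rw [elem, TensorProduct.add_tmul, map_add]; rfl

theorem elem_add_right (a : H) (b b' : K) : elem a (b + b') = elem a b + elem a b' := by
  rw [elem, TensorProduct.tmul_add, map_add]; rfl

theorem elem_smul_left (c : ℂ) (a : H) (b : K) : elem (c • a) b = c • elem a b := by
  rw [elem, ← TensorProduct.smul_tmul', map_smul]; rfl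

theorem elem_smul_right (c : ℂ) (a : H) (b : K) : elem a (c • b) = c • elem a b := by
  rw [elem, TensorProduct.tmul_smul, map_smul]; rfl

theorem elem_zero_left (b : K) : elem (0 : H) b = 0 := by
  rw [elem, TensorProduct.zero_tmul, map_zero]

theorem elem_zero_right (a : H) : elem a (0 : K) = 0 := by
  rw [elem, TensorProduct.tmul_zero, map_zero]

theorem elem_sum_left {ι : Type*} (s : Finset ι) (f : ι → H) (b : K) :
    elem (∑ i ∈ s, f i) b = ∑ i ∈ s, elem (f i) b :=
  map_sum (⟨⟨fun a => elem a b, elem_zero_left b⟩, fun a a' => elem_add_left a a' b⟩ :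
    H →+ HTensor H K) f s

theorem elem_sum_right {ι : Type*} (s : Finset ι) (a : H) (f : ι → K) :
    elem a (∑ i ∈ s, f i) = ∑ i ∈ s, elem a (f i) :=
  map_sum (⟨⟨fun b => elem a b, elem_zero_right a⟩, fun b b' => elem_add_right a b b'⟩ :
    K →+ HTensor H K) f s

variable [CompleteSpace H] [CompleteSpace K] [CompleteSpace H'] [CompleteSpace K']

theorem eq_adjoint_of_elem {S : HTensor H K →L[ℂ] HTensor H' K'}
    {T : HTensor H' K' →L[ℂ] HTensor H K}
    (h : ∀ a b c d, inner ℂ (S (elem a b)) (elem c d) = inner ℂ (elem a b) (T (elem c d))) :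
    S = ContinuousLinearMap.adjoint T := by
  rw [ContinuousLinearMap.eq_adjoint_iff]
  intro x y
  induction x using induction_coeT with
  | hP =>
    exact isClosed_eq (Continuous.inner (𝕜 := ℂ) S.continuous continuous_const)
      (Continuous.inner (𝕜 := ℂ) continuous_id continuous_const)
  | h x =>
    induction y using induction_coeT with
    | hP =>
      exact isClosed_eq (Continuous.inner (𝕜 := ℂ) continuous_const continuous_id)
        (Continuous.inner (𝕜 := ℂ) continuous_const T.continuous)
    | h y =>
      induction x using TensorProduct.induction_on with
      | zero => rw [map_zero, map_zero, inner_zero_left, inner_zero_left]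
      | add x x' hx hx' => rw [map_add, map_add, inner_add_left, inner_add_left, hx, hx']
      | tmul a b =>
        induction y using TensorProduct.induction_on with
        | zero => rw [map_zero, map_zero, inner_zero_right, inner_zero_right]
        | add y y' hy hy' => rw [map_add, map_add, inner_add_right, inner_add_right, hy, hy']
        | tmul c d => exact h a b c d

theorem star_opT (S : H →L[ℂ] H) (T : K →L[ℂ] K) : star (opT S T) = opT (star S) (star T) := by
  refine (eq_adjoint_of_elem fun a b c d => ?_).symm
  rw [opT_elem, opT_elem, inner_elem, inner_elem, ContinuousLinearMap.star_eq_adjoint,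
    ContinuousLinearMap.star_eq_adjoint, ContinuousLinearMap.adjoint_inner_left,
    ContinuousLinearMap.adjoint_inner_left]

end Hilbert

/-! ## The braiding -/

section Braiding

variable {N : ℕ} [NeZero N] {ω : ℂ}
variable {H : Type u} [NormedAddCommGroup H] [InnerProductSpace ℂ H] [CompleteSpace H]
variable {K : Type v} [NormedAddCommGroup K] [InnerProductSpace ℂ K] [CompleteSpace K]

/-- The orthogonal projection onto the vectors `ξ` of degree `m`, that is, with
`U t ξ = ω ^ (t * m) • ξ` for all `t`. -/
def degProj (ω : ℂ) (U : Multiplicative (ZMod N) →* unitary (H →L[ℂ] H)) (m : ZMod N) :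
    H →L[ℂ] H :=
  (N : ℂ)⁻¹ • ∑ t : ZMod N, rpow ω (-(t * m)) • (U (.ofAdd t) : H →L[ℂ] H)

/-- The braiding unitary, `ξ ⊗ η ↦ ω ^ (m * n) • η ⊗ ξ` for `ξ` of degree `m` and `η` of
degree `n`. -/
def braiding (ω : ℂ) (U : Multiplicative (ZMod N) →* unitary (H →L[ℂ] H))
    (V : Multiplicative (ZMod N) →* unitary (K →L[ℂ] K)) : HTensor H K →L[ℂ] HTensor K H :=
  ∑ m : ZMod N, ∑ n : ZMod N,
    rpow ω (m * n) • (flipT H K ∘L opT (degProj ω U m) (degProj ω V n))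

/-- The dual braiding unitary, `η ⊗ ξ ↦ ω ^ (-(m * n)) • ξ ⊗ η` for `ξ` of degree `m` and `η` of
degree `n`. -/
def braidingDual (ω : ℂ) (U : Multiplicative (ZMod N) →* unitary (H →L[ℂ] H))
    (V : Multiplicative (ZMod N) →* unitary (K →L[ℂ] K)) : HTensor K H →L[ℂ] HTensor H K :=
  ∑ m : ZMod N, ∑ n : ZMod N,
    rpow ω (-(m * n)) • (flipT K H ∘L opT (degProj ω V n) (degProj ω U m))

theorem U_add_apply (U : Multiplicative (ZMod N) →* unitary (H →L[ℂ] H)) (s t : ZMod N) :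
    (U (.ofAdd s) : H →L[ℂ] H) * (U (.ofAdd t) : H →L[ℂ] H) = U (.ofAdd (s + t)) := by
  rw [ofAdd_add, map_mul]; rfl

theorem U_zero (U : Multiplicative (ZMod N) →* unitary (H →L[ℂ] H)) :
    (U (.ofAdd 0) : H →L[ℂ] H) = 1 := by
  rw [ofAdd_zero, map_one]; rfl

theorem star_U (U : Multiplicative (ZMod N) →* unitary (H →L[ℂ] H)) (t : ZMod N) :
    star (U (.ofAdd t) : H →L[ℂ] H) = U (.ofAdd (-t)) := by
  rw [ofAdd_neg, map_inv]; rfl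

theorem U_mul_degProj (hω : IsPrimitiveRoot ω N)
    (U : Multiplicative (ZMod N) →* unitary (H →L[ℂ] H)) (t m : ZMod N) :
    (U (.ofAdd t) : H →L[ℂ] H) * degProj ω U m = rpow ω (t * m) • degProj ω U m := by
  rw [degProj, mul_smul_comm, smul_comm (rpow ω (t * m))]
  refine congrArg (fun x : H →L[ℂ] H => (N : ℂ)⁻¹ • x) ?_
  rw [Finset.mul_sum, Finset.smul_sum]
  refine Fintype.sum_equiv (Equiv.addLeft t) _ _ fun s => ?_
  rw [Equiv.coe_addLeft, mul_smul_comm, U_add_apply, smul_smul, ← rpow_add hω]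
  congr 2; ring

theorem degProj_mul_degProj (hω : IsPrimitiveRoot ω N)
    (U : Multiplicative (ZMod N) →* unitary (H →L[ℂ] H)) (m n : ZMod N) :
    degProj ω U m * degProj ω U n = if m = n then degProj ω U n else 0 := by
  have h : degProj ω U m * degProj ω U n =
      ((N : ℂ)⁻¹ * ∑ t : ZMod N, rpow ω (t * (n - m))) • degProj ω U n := by
    conv_lhs => rw [degProj]
    rw [smul_mul_assoc, Finset.sum_mul, mul_smul, Finset.sum_smul]
    congr 1
    refine Finset.sum_congr rfl fun t _ => ?_
    rw [smul_mul_assoc, U_mul_degProj hω, smul_smul, ← rpow_add hω]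
    congr 2; ring
  rw [h, sum_rpow hω]
  have hN : (N : ℂ) ≠ 0 := Nat.cast_ne_zero.2 (NeZero.ne N)
  by_cases hmn : m = n
  · simp [hmn, hN]
  · rw [if_neg (sub_ne_zero.2 (Ne.symm hmn)), if_neg hmn, mul_zero, zero_smul]

theorem sum_degProj (hω : IsPrimitiveRoot ω N)
    (U : Multiplicative (ZMod N) →* unitary (H →L[ℂ] H)) : ∑ m, degProj ω U m = 1 := by
  have hN : (N : ℂ) ≠ 0 := Nat.cast_ne_zero.2 (NeZero.ne N)
  simp only [degProj]
  have this : ∀ t : ZMod N, ∑ m : ZMod N, rpow ω (-(t * m)) • (U (.ofAdd t) : H →L[ℂ] H) =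
      if t = 0 then (N : ℂ) • 1 else 0 := fun t => by
    rw [← Finset.sum_smul]
    have h := sum_rpow hω (-t)
    simp only [mul_neg, mul_comm _ t] at h
    rw [h]
    simp only [neg_eq_zero, ite_smul, zero_smul]
    split_ifs with ht
    · rw [ht, U_zero]
    · rfl
  rw [← Finset.smul_sum, Finset.sum_comm, Finset.sum_congr rfl fun t _ => this t,
    Finset.sum_ite_eq', if_pos (Finset.mem_univ _),
    smul_smul, inv_mul_cancel₀ hN, one_smul]

theorem star_degProj (hω : IsPrimitiveRoot ω N)
    (U : Multiplicative (ZMod N) →* unitary (H →L[ℂ] H)) (m : ZMod N) :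
    star (degProj ω U m) = degProj ω U m := by
  rw [degProj, star_smul, star_sum, ← Equiv.sum_comp (Equiv.neg (ZMod N))]
  congr 1
  · simp
  · refine Finset.sum_congr rfl fun t _ => ?_
    rw [star_smul, star_rpow hω, star_U]
    simp

theorem braiding_elem (U : Multiplicative (ZMod N) →* unitary (H →L[ℂ] H))
    (V : Multiplicative (ZMod N) →* unitary (K →L[ℂ] K)) (a : H) (b : K) :
    braiding ω U V (elem a b) =
      ∑ m, ∑ n, rpow ω (m * n) • elem (degProj ω V n b) (degProj ω U m a) := by
  simp [braiding, opT_elem, flipT_elem]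

theorem braidingDual_elem (U : Multiplicative (ZMod N) →* unitary (H →L[ℂ] H))
    (V : Multiplicative (ZMod N) →* unitary (K →L[ℂ] K)) (b : K) (a : H) :
    braidingDual ω U V (elem b a) =
      ∑ m, ∑ n, rpow ω (-(m * n)) • elem (degProj ω U m a) (degProj ω V n b) := by
  simp [braidingDual, opT_elem, flipT_elem]

theorem degProj_apply_degProj (hω : IsPrimitiveRoot ω N)
    (U : Multiplicative (ZMod N) →* unitary (H →L[ℂ] H)) (m n : ZMod N) (a : H) :
    degProj ω U m (degProj ω U n a) = if m = n then degProj ω U n a else 0 := by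
  have := congrArg (fun T : H →L[ℂ] H => T a) (degProj_mul_degProj hω U m n)
  refine (this : degProj ω U m (degProj ω U n a) = _).trans ?_
  split_ifs <;> rfl

theorem sum_degProj_apply (hω : IsPrimitiveRoot ω N)
    (U : Multiplicative (ZMod N) →* unitary (H →L[ℂ] H)) (a : H) :
    ∑ m, degProj ω U m a = a := by
  have := congrArg (fun T : H →L[ℂ] H => T a) (sum_degProj hω U)
  simpa [sum_apply] using this

theorem ite_elem (p : Prop) [Decidable p] (a : H) (b : K) :
    elem (if p then a else 0) b = if p then elem a b else 0 := by
  split_ifs <;> simp [elem_zero_left]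

theorem elem_ite (p : Prop) [Decidable p] (a : H) (b : K) :
    elem a (if p then b else 0) = if p then elem a b else 0 := by
  split_ifs <;> simp [elem_zero_right]

theorem braidingDual_comp_braiding (hω : IsPrimitiveRoot ω N)
    (U : Multiplicative (ZMod N) →* unitary (H →L[ℂ] H))
    (V : Multiplicative (ZMod N) →* unitary (K →L[ℂ] K)) :
    braidingDual ω U V ∘L braiding ω U V = 1 := by
  refine ext_elem fun a b => ?_
  simp only [ContinuousLinearMap.comp_apply, braiding_elem, map_sum, map_smul, braidingDual_elem,
    degProj_apply_degProj hω, ite_elem, elem_ite, smul_ite, smul_zero, Finset.sum_ite_eq',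
    Finset.mem_univ, if_true, smul_smul, rpow_mul_neg hω, one_smul]
  simp only [← elem_sum_right, ← elem_sum_left, sum_degProj_apply hω]
  rfl

theorem braiding_comp_braidingDual (hω : IsPrimitiveRoot ω N)
    (U : Multiplicative (ZMod N) →* unitary (H →L[ℂ] H))
    (V : Multiplicative (ZMod N) →* unitary (K →L[ℂ] K)) :
    braiding ω U V ∘L braidingDual ω U V = 1 := by
  refine ext_elem fun b a => ?_
  simp only [ContinuousLinearMap.comp_apply, braiding_elem, map_sum, map_smul, braidingDual_elem,
    degProj_apply_degProj hω, ite_elem, elem_ite, smul_ite, smul_zero, Finset.sum_ite_eq',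
    Finset.sum_ite_irrel, Finset.sum_const_zero,
    Finset.mem_univ, if_true, smul_smul, rpow_neg_mul hω, one_smul]
  rw [Finset.sum_comm]
  simp only [← elem_sum_right, ← elem_sum_left, sum_degProj_apply hω]
  rfl

theorem inner_degProj (hω : IsPrimitiveRoot ω N)
    (U : Multiplicative (ZMod N) →* unitary (H →L[ℂ] H)) (m : ZMod N) (a b : H) :
    inner ℂ (degProj ω U m a) b = inner ℂ a (degProj ω U m b) := by
  conv_lhs => rw [← star_degProj hω, ContinuousLinearMap.star_eq_adjoint,
    ContinuousLinearMap.adjoint_inner_left]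

theorem adjoint_braiding (hω : IsPrimitiveRoot ω N)
    (U : Multiplicative (ZMod N) →* unitary (H →L[ℂ] H))
    (V : Multiplicative (ZMod N) →* unitary (K →L[ℂ] K)) :
    ContinuousLinearMap.adjoint (braiding ω U V) = braidingDual ω U V := by
  refine (eq_adjoint_of_elem fun b a c d => ?_).symm
  rw [braidingDual_elem, braiding_elem, sum_inner, inner_sum]
  refine Finset.sum_congr rfl fun m _ => ?_
  rw [sum_inner, inner_sum]
  refine Finset.sum_congr rfl fun n _ => ?_
  rw [inner_smul_left, inner_smul_right, inner_elem, inner_elem, inner_degProj hω,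
    inner_degProj hω]
  have : (starRingEnd ℂ) (rpow ω (-(m * n))) = rpow ω (m * n) := by
    have := star_rpow hω (-(m * n))
    rwa [neg_neg] at this
  rw [this]
  ring

end Braiding

/-! ## The braided tensor product -/

section Braided

variable {N : ℕ} [NeZero N] {ω : ℂ} (hω : IsPrimitiveRoot ω N)
variable {H : Type u} [NormedAddCommGroup H] [InnerProductSpace ℂ H] [CompleteSpace H]
variable {K : Type v} [NormedAddCommGroup K] [InnerProductSpace ℂ K] [CompleteSpace K]
variable {A : Type*} [CStarAlgebra A] {α : ZNAction N A}
variable {B : Type*} [CStarAlgebra B] {β : ZNAction N B}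
variable (R : CovRep α H) (S : CovRep β K)

/-- The tensor product of two unitary representations of `ℤ/Nℤ`. -/
def tensorU (U : Multiplicative (ZMod N) →* unitary (H →L[ℂ] H))
    (V : Multiplicative (ZMod N) →* unitary (K →L[ℂ] K)) :
    Multiplicative (ZMod N) →* unitary (HTensor H K →L[ℂ] HTensor H K) where
  toFun t := ⟨opT (U t : H →L[ℂ] H) (V t : K →L[ℂ] K), by
    rw [Unitary.mem_iff, star_opT, opT_mul, opT_mul]
    simp [opT_one]⟩
  map_one' := Subtype.ext <| by simp [opT_one]
  map_mul' s t := Subtype.ext <| by simp [opT_mul]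

/-- The unital C*-subalgebra generated by a subset of a C*-algebra. -/
def generated {E : Type w} [CStarAlgebra E] (s : Set E) : StarSubalgebra ℂ E :=
  (StarAlgebra.adjoin ℂ s).topologicalClosure

theorem subset_generated {E : Type w} [CStarAlgebra E] {s : Set E} {x : E} (h : x ∈ s) :
    x ∈ generated s :=
  StarSubalgebra.le_topologicalClosure _ (StarAlgebra.subset_adjoin ℂ s h)

instance isClosed_generated {E : Type w} [CStarAlgebra E] (s : Set E) :
    IsClosed (generated s : Set E) :=
  StarSubalgebra.isClosed_topologicalClosure _

theorem generated_le_comap {E : Type w} [CStarAlgebra E] {s : Set E} (φ : E →⋆ₐ[ℂ] E)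
    (h : ∀ x ∈ s, φ x ∈ generated s) {x : E} (hx : x ∈ generated s) : φ x ∈ generated s := by
  have hle : generated s ≤ (generated s).comap φ :=
    StarSubalgebra.topologicalClosure_minimal (StarAlgebra.adjoin_le h)
      (IsClosed.preimage (continuous_hom φ) (isClosed_generated s))
  exact hle hx

/-- The operator `j₁(a) = a ⊗ id`. -/
def leg1 : A →⋆ₐ[ℂ] (HTensor H K →L[ℂ] HTensor H K) where
  toFun a := opT (R.π a) 1
  map_one' := by rw [map_one, opT_one]
  map_mul' a b := by rw [map_mul, opT_mul, one_mul]
  map_zero' := ext_elem fun a b => by simp [opT_elem, elem_zero_left]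
  map_add' x y := ext_elem fun a b => by simp [opT_elem, elem_add_left]
  commutes' c := ext_elem fun a b => by
    simp [opT_elem, elem_smul_left, Algebra.algebraMap_eq_smul_one]
  map_star' x := by rw [map_star, star_opT, star_one]

/-- The operator `j₂(b) = c ∘ (b ⊗ id) ∘ c'`, where `c'` is the braiding unitary and `c` is the
dual braiding unitary. -/
def leg2 : B →⋆ₐ[ℂ] (HTensor H K →L[ℂ] HTensor H K) where
  toFun b := braidingDual ω R.U S.U ∘L opT (S.π b) 1 ∘L braiding ω R.U S.U
  map_one' := by
    rw [map_one, opT_one]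
    exact braidingDual_comp_braiding hω R.U S.U
  map_mul' a b := by
    have h := braiding_comp_braidingDual hω R.U S.U
    rw [map_mul, ← one_mul (1 : H →L[ℂ] H), ← opT_mul]
    ext x
    have hx := fun y => congrArg (fun T : HTensor K H →L[ℂ] HTensor K H => T y) h
    simp only [ContinuousLinearMap.comp_apply] at hx
    change _ = braidingDual ω R.U S.U (opT (S.π a) 1 (braiding ω R.U S.U
      (braidingDual ω R.U S.U (opT (S.π b) 1 (braiding ω R.U S.U x)))))
    rw [hx]
    rfl
  map_zero' := by
    have : opT (S.π 0) (1 : H →L[ℂ] H) = 0 :=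
      ext_elem fun a b => by simp [opT_elem, elem_zero_left]
    rw [this]; simp
  map_add' x y := by
    have : opT (S.π (x + y)) (1 : H →L[ℂ] H) = opT (S.π x) 1 + opT (S.π y) 1 :=
      ext_elem fun a b => by simp [opT_elem, elem_add_left]
    rw [this]; simp
  commutes' c := by
    have : opT (S.π (algebraMap ℂ B c)) (1 : H →L[ℂ] H) = c • 1 :=
      ext_elem fun a b => by
        simp [opT_elem, elem_smul_left, Algebra.algebraMap_eq_smul_one]
    rw [this, Algebra.algebraMap_eq_smul_one, ← braidingDual_comp_braiding hω R.U S.U]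
    ext x
    simp
  map_star' x := by
    rw [map_star, ContinuousLinearMap.star_eq_adjoint (_ ∘L _), ContinuousLinearMap.adjoint_comp,
      ContinuousLinearMap.adjoint_comp, adjoint_braiding hω, ← adjoint_braiding hω,
      ContinuousLinearMap.adjoint_adjoint, ← ContinuousLinearMap.star_eq_adjoint (opT _ _),
      star_opT, star_one]
    rfl

/-- The braided tensor product of two `ℤ/Nℤ`-C*-algebras: the C*-algebra of operators on `H ⊗ K`
generated by the products `j₁(a) j₂(b)`. -/
def braided : StarSubalgebra ℂ (HTensor H K →L[ℂ] HTensor H K) :=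
  generated {T | ∃ (a : A) (b : B), T = leg1 (K := K) R a * leg2 hω R S b}

instance : IsClosed (braided hω R S : Set (HTensor H K →L[ℂ] HTensor H K)) :=
  isClosed_generated _

/-- The braided tensor product, as a C*-algebra. -/
def BraidedTensor : Type (max u v) := ↥(braided hω R S)

instance : CStarAlgebra (BraidedTensor hω R S) :=
  inferInstanceAs (CStarAlgebra ↥(braided hω R S))

theorem leg_mul_leg_mem (a : A) (b : B) :
    leg1 (K := K) R a * leg2 hω R S b ∈ braided hω R S :=
  subset_generated ⟨a, b, rfl⟩

/-- The embedding `j₁` of the first factor. -/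
def j₁ : A →⋆ₐ[ℂ] BraidedTensor hω R S :=
  (leg1 (K := K) R).codRestrict (braided hω R S) fun a => by
    simpa using leg_mul_leg_mem hω R S a 1

/-- The embedding `j₂` of the second factor. -/
def j₂ : B →⋆ₐ[ℂ] BraidedTensor hω R S :=
  (leg2 hω R S).codRestrict (braided hω R S) fun b => by
    simpa using leg_mul_leg_mem hω R S 1 b

theorem degProj_U (U : Multiplicative (ZMod N) →* unitary (H →L[ℂ] H)) (m t : ZMod N) (a : H) :
    degProj ω U m ((U (.ofAdd t) : H →L[ℂ] H) a) = (U (.ofAdd t) : H →L[ℂ] H) (degProj ω U m a) := by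
  have h : degProj ω U m * (U (.ofAdd t) : H →L[ℂ] H) =
      (U (.ofAdd t) : H →L[ℂ] H) * degProj ω U m := by
    rw [degProj, smul_mul_assoc, mul_smul_comm, Finset.sum_mul, Finset.mul_sum]
    refine congrArg _ (Finset.sum_congr rfl fun s _ => ?_)
    rw [smul_mul_assoc, mul_smul_comm, U_add_apply, U_add_apply, add_comm]
  exact congrArg (fun T : H →L[ℂ] H => T a) h

theorem braiding_comp_tensorU (U : Multiplicative (ZMod N) →* unitary (H →L[ℂ] H))
    (V : Multiplicative (ZMod N) →* unitary (K →L[ℂ] K)) (t : ZMod N) :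
    braiding ω U V ∘L (tensorU U V (.ofAdd t) : HTensor H K →L[ℂ] HTensor H K) =
      (tensorU V U (.ofAdd t) : HTensor K H →L[ℂ] HTensor K H) ∘L braiding ω U V :=
  ext_elem fun a b => by
    simp only [ContinuousLinearMap.comp_apply, tensorU, MonoidHom.coe_mk, OneHom.coe_mk, opT_elem,
      braiding_elem, degProj_U, map_sum, map_smul]

theorem tensorU_comp_braidingDual (U : Multiplicative (ZMod N) →* unitary (H →L[ℂ] H))
    (V : Multiplicative (ZMod N) →* unitary (K →L[ℂ] K)) (t : ZMod N) :
    (tensorU U V (.ofAdd t) : HTensor H K →L[ℂ] HTensor H K) ∘L braidingDual ω U V =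
      braidingDual ω U V ∘L (tensorU V U (.ofAdd t) : HTensor K H →L[ℂ] HTensor K H) :=
  ext_elem fun a b => by
    simp only [ContinuousLinearMap.comp_apply, tensorU, MonoidHom.coe_mk, OneHom.coe_mk, opT_elem,
      braidingDual_elem, degProj_U, map_sum, map_smul]

theorem conj_leg1 (t : ZMod N) (a : A) :
    (tensorU R.U S.U (.ofAdd t) : HTensor H K →L[ℂ] HTensor H K) * leg1 R a *
      star (tensorU R.U S.U (.ofAdd t) : HTensor H K →L[ℂ] HTensor H K) = leg1 R (α.ρ t a) := by
  change opT _ _ * opT _ _ * star (opT _ _) = opT _ _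
  rw [star_opT, opT_mul, opT_mul, R.covariant]
  simp

theorem conj_leg2 (t : ZMod N) (b : B) :
    (tensorU R.U S.U (.ofAdd t) : HTensor H K →L[ℂ] HTensor H K) * leg2 hω R S b *
      star (tensorU R.U S.U (.ofAdd t) : HTensor H K →L[ℂ] HTensor H K) =
      leg2 hω R S (β.ρ t b) := by
  have h1 := tensorU_comp_braidingDual (ω := ω) R.U S.U t
  have h2 := braiding_comp_tensorU (ω := ω) R.U S.U (-t)
  have h3 : (tensorU S.U R.U (.ofAdd t) : HTensor K H →L[ℂ] HTensor K H) * opT (S.π b) 1 *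
      (tensorU S.U R.U (.ofAdd (-t)) : HTensor K H →L[ℂ] HTensor K H) =
      opT (S.π (β.ρ t b)) 1 := by
    rw [← star_U]
    exact conj_leg1 S R t b
  rw [star_U]
  change (_ ∘L (_ ∘L _ ∘L _)) ∘L _ = _ ∘L _ ∘L _
  rw [← h3]
  ext x
  have h1' := fun y => congrArg (fun T : HTensor K H →L[ℂ] HTensor H K => T y) h1
  have h2' := fun y => congrArg (fun T : HTensor H K →L[ℂ] HTensor K H => T y) h2
  simp only [ContinuousLinearMap.comp_apply] at h1' h2' ⊢
  rw [h1', h2']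
  rfl

/-- Conjugation by a unitary. -/
def conj (u : unitary (H →L[ℂ] H)) : (H →L[ℂ] H) →⋆ₐ[ℂ] (H →L[ℂ] H) where
  toFun x := (u : H →L[ℂ] H) * x * star (u : H →L[ℂ] H)
  map_one' := by simp
  map_mul' x y := by
    have : star (u : H →L[ℂ] H) * u = 1 := Unitary.star_mul_self_of_mem u.2
    calc (u : H →L[ℂ] H) * (x * y) * star (u : H →L[ℂ] H)
        = u * x * 1 * y * star (u : H →L[ℂ] H) := by simp only [mul_assoc, one_mul]
      _ = u * x * star (u : H →L[ℂ] H) * (u * y * star (u : H →L[ℂ] H)) := by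
        rw [← this]; simp only [mul_assoc]
  map_zero' := by simp
  map_add' x y := by rw [mul_add, add_mul]
  commutes' c := by
    rw [← Algebra.commutes, mul_assoc, Unitary.mul_star_self_of_mem u.2, mul_one]
  map_star' x := by simp [mul_assoc]

theorem conj_apply (u : unitary (H →L[ℂ] H)) (x : H →L[ℂ] H) :
    conj u x = (u : H →L[ℂ] H) * x * star (u : H →L[ℂ] H) := rfl

theorem conj_zero (U : Multiplicative (ZMod N) →* unitary (H →L[ℂ] H)) (x : H →L[ℂ] H) :
    conj (U (.ofAdd 0)) x = x := by
  rw [conj_apply, U_zero]; simp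

theorem conj_add (U : Multiplicative (ZMod N) →* unitary (H →L[ℂ] H)) (s t : ZMod N)
    (x : H →L[ℂ] H) : conj (U (.ofAdd (s + t))) x = conj (U (.ofAdd s)) (conj (U (.ofAdd t)) x) := by
  rw [conj_apply, conj_apply, conj_apply, ← U_add_apply, star_mul]
  simp only [mul_assoc]

theorem conj_mem (t : ZMod N) (T : HTensor H K →L[ℂ] HTensor H K) (hT : T ∈ braided hω R S) :
    conj (tensorU R.U S.U (.ofAdd t)) T ∈ braided hω R S := by
  refine generated_le_comap _ ?_ hT
  rintro _ ⟨a, b, rfl⟩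
  have e1 : conj (tensorU R.U S.U (.ofAdd t)) (leg1 R a) = leg1 R (α.ρ t a) :=
    (conj_apply _ _).trans (conj_leg1 R S t a)
  have e2 : conj (tensorU R.U S.U (.ofAdd t)) (leg2 hω R S b) = leg2 hω R S (β.ρ t b) :=
    (conj_apply _ _).trans (conj_leg2 hω R S t b)
  rw [map_mul, e1, e2]
  exact leg_mul_leg_mem hω R S _ _

/-- The action of `ℤ/Nℤ` on the braided tensor product, for which `j₁` and `j₂` are equivariant. -/
def braidedAction : ZNAction N (BraidedTensor hω R S) where
  ρ t :=
    { toFun := fun T => ⟨conj (tensorU R.U S.U (.ofAdd t)) T.1, conj_mem hω R S t T.1 T.2⟩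
      map_one' := Subtype.ext (map_one (conj _))
      map_mul' := fun _ _ => Subtype.ext (map_mul (conj _) _ _)
      map_zero' := Subtype.ext (map_zero (conj _))
      map_add' := fun _ _ => Subtype.ext (map_add (conj _) _ _)
      commutes' := fun c => Subtype.ext (AlgHomClass.commutes (conj _) c)
      map_star' := fun _ => Subtype.ext (map_star (conj _) _) }
  ρ_zero T := Subtype.ext (conj_zero (tensorU R.U S.U) T.1)
  ρ_add s t T := Subtype.ext (conj_add (tensorU R.U S.U) s t T.1)

/-- The defining representation of the braided tensor product on `H ⊗ K`. -/
def braidedRep : CovRep (braidedAction hω R S) (HTensor H K) where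
  U := tensorU R.U S.U
  π := ((braided hω R S).subtype : ↥(braided hω R S) →⋆ₐ[ℂ] _)
  faithful := Subtype.val_injective
  covariant _ _ := rfl

/-! ## The minimal tensor product -/

/-- The minimal tensor product of two C*-algebras, on the Hilbert space tensor product of the
spaces on which they are faithfully represented. -/
def minSubalgebra : StarSubalgebra ℂ (HTensor H K →L[ℂ] HTensor H K) :=
  generated {T | ∃ (a : A) (b : B), T = opT (R.π a) (S.π b)}

instance : IsClosed (minSubalgebra R S : Set (HTensor H K →L[ℂ] HTensor H K)) :=
  isClosed_generated _

/-- The minimal tensor product, as a C*-algebra. -/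
def MinTensor : Type (max u v) := ↥(minSubalgebra R S)

instance : CStarAlgebra (MinTensor R S) :=
  inferInstanceAs (CStarAlgebra ↥(minSubalgebra R S))

/-- The elementary tensor `a ⊗ b` in the minimal tensor product. -/
def minTmul (a : A) (b : B) : MinTensor R S :=
  ⟨opT (R.π a) (S.π b),
    subset_generated ⟨a, b, rfl⟩⟩

end Braided

/-! ## The function algebra of `ℤ/Nℤ` -/

section CZ

variable {N : ℕ} [NeZero N]

variable (N) in
/-- The C*-algebra `C(ℤ/Nℤ)`. -/
abbrev CZ : Type := ZMod N → ℂ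

variable (N) in
/-- The right translation action of `ℤ/Nℤ` on `C(ℤ/Nℤ)`, given by the comultiplication
`Δ(f)(s, t) = f(s + t)`. -/
def czAction : ZNAction N (CZ N) where
  ρ t :=
    { toFun := fun f s => f (s + t)
      map_one' := rfl
      map_mul' := fun _ _ => rfl
      map_zero' := rfl
      map_add' := fun _ _ => rfl
      commutes' := fun _ => rfl
      map_star' := fun _ => rfl }
  ρ_zero f := funext fun s => congrArg f (add_zero s)
  ρ_add s t f := funext fun r => congrArg f (by ring)

variable (N) in
/-- The translation representation of `ℤ/Nℤ` on `ℓ²(ℤ/Nℤ)`, `(U t ξ)(s) = ξ(s + t)`. -/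
def czU : Multiplicative (ZMod N) →*
    unitary (EuclideanSpace ℂ (ZMod N) →L[ℂ] EuclideanSpace ℂ (ZMod N)) where
  toFun t := Unitary.linearIsometryEquiv.symm
    (LinearIsometryEquiv.piLpCongrLeft 2 ℂ ℂ (Equiv.subRight t.toAdd))
  map_one' := by
    ext x s
    simp
  map_mul' s t := by
    ext x r
    simp [add_assoc]

theorem czU_apply (t s : ZMod N) (ξ : EuclideanSpace ℂ (ZMod N)) :
    (czU N (.ofAdd t) : EuclideanSpace ℂ (ZMod N) →L[ℂ] EuclideanSpace ℂ (ZMod N)) ξ s =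
      ξ (s + t) := rfl

variable (N) in
/-- The representation of `C(ℤ/Nℤ)` on `ℓ²(ℤ/Nℤ)` by pointwise multiplication. -/
def czRep : CovRep (czAction N) (EuclideanSpace ℂ (ZMod N)) where
  U := czU N
  π :=
    { toFun := fun f => Matrix.toEuclideanCLM (n := ZMod N) (𝕜 := ℂ) (Matrix.diagonal f)
      map_one' := by
        change Matrix.toEuclideanCLM (n := ZMod N) (𝕜 := ℂ) (Matrix.diagonal fun _ => 1) = 1
        rw [Matrix.diagonal_one, map_one]
      map_mul' := fun f g => by
        rw [← map_mul, Matrix.diagonal_mul_diagonal]; rfl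
      map_zero' := by
        change Matrix.toEuclideanCLM (n := ZMod N) (𝕜 := ℂ) (Matrix.diagonal fun _ => 0) = 0
        rw [Matrix.diagonal_zero, map_zero]
      map_add' := fun f g => by
        rw [← map_add, Matrix.diagonal_add]; rfl
      commutes' := fun c => by
        rw [← AlgHomClass.commutes (Matrix.toEuclideanCLM (n := ZMod N) (𝕜 := ℂ)) c,
          Matrix.algebraMap_eq_diagonal]
      map_star' := fun f => by
        rw [← map_star, Matrix.star_eq_conjTranspose, Matrix.diagonal_conjTranspose] }
  faithful f g h := Matrix.diagonal_injective (EquivLike.injective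
    (Matrix.toEuclideanCLM (n := ZMod N) (𝕜 := ℂ)) h)
  covariant t f := by
    rw [star_U]
    ext ξ s
    change _ = (czU N (.ofAdd t) : EuclideanSpace ℂ (ZMod N) →L[ℂ] EuclideanSpace ℂ (ZMod N)) _ s
    rw [czU_apply]
    change (Matrix.diagonal _).mulVec _ s = (Matrix.diagonal _).mulVec _ (s + t)
    rw [Matrix.mulVec_diagonal, Matrix.mulVec_diagonal]
    change f (s + t) * ξ s = f (s + t) * ξ (s + t + -t)
    rw [add_neg_cancel_right]

/-- The generator `z` of `C(ℤ/Nℤ)`, `z(t) = ω ^ t`. -/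
def czGen (ω : ℂ) : CZ N := fun t => rpow ω t

/-- The indicator function of `t`. -/
def czDelta (t : ZMod N) : CZ N := Pi.single t 1

end CZ

/-! ## The action on `C(S_N^+(R))` and the bosonization -/

section Boson

variable {N : ℕ} [NeZero N] {ω : ℂ} (hω : IsPrimitiveRoot ω N)

theorem permRel_scale (hω : IsPrimitiveRoot ω N) (t : ZMod N) :
    PermRel ω (fun i j : ZMod N => rpow ω (t * (j - i)) • CPerm.q ω i j) where
  row_zero i := by
    rw [(CPerm.rel ω).row_zero]
    split_ifs with h
    · simp [h, rpow_zero]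
    · simp
  col_zero i := by
    rw [(CPerm.rel ω).col_zero]
    split_ifs with h
    · simp [h, rpow_zero]
    · simp
  star_eq i j := by
    rw [star_smul, (CPerm.rel ω).star_eq, star_rpow hω, smul_smul, smul_smul, mul_comm]
    congr 3; ring
  mul_col i j k := by
    rw [(CPerm.rel ω).mul_col, Finset.smul_sum]
    refine Finset.sum_congr rfl fun l _ => ?_
    rw [smul_mul_smul_comm, smul_smul, smul_smul, mul_comm, ← rpow_add hω (t * _)]
    congr 3; ring
  mul_row i j k := by
    rw [(CPerm.rel ω).mul_row, Finset.smul_sum]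
    refine Finset.sum_congr rfl fun l _ => ?_
    rw [smul_mul_smul_comm, smul_smul, smul_smul, mul_comm, ← rpow_add hω (t * _)]
    congr 3; ring

/-- The action of `ℤ/Nℤ` on `C(S_N^+(R))`, with `ρ t (q i j) = ω ^ (t * (j - i)) • q i j`. -/
def permAction : ZNAction N (CPerm N ω) where
  ρ t := CPerm.lift (permRel_scale hω t)
  ρ_zero a := by
    refine DFunLike.congr_fun (g := StarAlgHom.id ℂ (CPerm N ω)) (CPerm.hom_ext fun i j => ?_) a
    rw [CPerm.lift_q]; simp [rpow_zero]
  ρ_add s t a := by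
    refine DFunLike.congr_fun (g := (CPerm.lift (permRel_scale hω s)).comp
      (CPerm.lift (permRel_scale hω t))) (CPerm.hom_ext fun i j => ?_) a
    rw [StarAlgHom.comp_apply, CPerm.lift_q, CPerm.lift_q, map_smul, CPerm.lift_q, smul_smul,
      ← rpow_add hω]
    congr 2; ring

theorem permAction_q (t i j : ZMod N) :
    (permAction hω).ρ t (CPerm.q ω i j) = rpow ω (t * (j - i)) • CPerm.q ω i j :=
  CPerm.lift_q (permRel_scale hω t) i j

section General

variable {H : Type u} [NormedAddCommGroup H] [InnerProductSpace ℂ H] [CompleteSpace H]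
variable {K : Type v} [NormedAddCommGroup K] [InnerProductSpace ℂ K] [CompleteSpace K]
variable {A : Type*} [CStarAlgebra A] {α : ZNAction N A}
variable {B : Type*} [CStarAlgebra B] {β : ZNAction N B}

/-- The canonical morphism
`ψ : C(ℤ/Nℤ) ⊠ X ⊠ Y → (C(ℤ/Nℤ) ⊠ X) ⊗ (C(ℤ/Nℤ) ⊠ Y)`, characterized by
`ψ(j₁(f)) = (j₁ ⊗ j₁)(Δ(f))`, `ψ(j₂(a)) = (j₂ ⊗ j₁)(ρ(a))` and `ψ(j₃(b)) = 1 ⊗ j₂(b)`, where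
`Δ(f) = ∑ f(s + t) δ_s ⊗ δ_t` and `ρ(a) = ∑ ρ_t(a) ⊗ δ_t`. -/
def IsPsi (R : CovRep α H) (S : CovRep β K)
    (ψ : BraidedTensor hω (czRep N) (braidedRep hω R S) →⋆ₐ[ℂ]
      MinTensor (braidedRep hω (czRep N) R) (braidedRep hω (czRep N) S)) : Prop :=
  (∀ f : CZ N, ψ (j₁ hω (czRep N) (braidedRep hω R S) f) =
    ∑ s : ZMod N, ∑ t : ZMod N,
      f (s + t) • minTmul (braidedRep hω (czRep N) R) (braidedRep hω (czRep N) S)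
        (j₁ hω (czRep N) R (czDelta s)) (j₁ hω (czRep N) S (czDelta t))) ∧
  (∀ a : A, ψ (j₂ hω (czRep N) (braidedRep hω R S) (j₁ hω R S a)) =
    ∑ t : ZMod N, minTmul (braidedRep hω (czRep N) R) (braidedRep hω (czRep N) S)
      (j₂ hω (czRep N) R (α.ρ t a)) (j₁ hω (czRep N) S (czDelta t))) ∧
  ∀ b : B, ψ (j₂ hω (czRep N) (braidedRep hω R S) (j₂ hω R S b)) =
    minTmul (braidedRep hω (czRep N) R) (braidedRep hω (czRep N) S)
      1 (j₂ hω (czRep N) S b)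

/-- The underlying C*-algebra `C(ℤ/Nℤ) ⊠ A` of the bosonization. -/
abbrev Boson (R : CovRep α H) : Type _ := BraidedTensor hω (czRep N) R

/-- The tensor square of the underlying C*-algebra of the bosonization. -/
abbrev BosonSq (R : CovRep α H) : Type _ :=
  MinTensor (braidedRep hω (czRep N) R) (braidedRep hω (czRep N) R)

/-- The elementary tensor `x ⊗ y` in the tensor square of the bosonization. -/
def bosonTmul (R : CovRep α H) (x y : Boson hω R) : BosonSq hω R :=
  minTmul (braidedRep hω (czRep N) R) (braidedRep hω (czRep N) R) x y

/-- `D` is the comultiplication `ψ ∘ (id ⊠ Δ)` of the bosonization of `(A, α, Δ)`. -/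
def IsBosonComult (R : CovRep α H) (Δ : A →⋆ₐ[ℂ] BraidedTensor hω R R)
    (D : Boson hω R →⋆ₐ[ℂ] BosonSq hω R) : Prop :=
  ∃ (idΔ : Boson hω R →⋆ₐ[ℂ] BraidedTensor hω (czRep N) (braidedRep hω R R))
    (ψ : BraidedTensor hω (czRep N) (braidedRep hω R R) →⋆ₐ[ℂ] BosonSq hω R),
    (∀ (f : CZ N) (a : A), idΔ (j₁ hω (czRep N) R f * j₂ hω (czRep N) R a) =
      j₁ hω (czRep N) (braidedRep hω R R) f * j₂ hω (czRep N) (braidedRep hω R R) (Δ a)) ∧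
    IsPsi hω R R ψ ∧ D = ψ.comp idΔ

end General

section PermBoson

variable {L : Type u} [NormedAddCommGroup L] [InnerProductSpace ℂ L] [CompleteSpace L]
variable (R : CovRep (permAction hω) L)

/-- The comultiplication of `S_N^+(R)`: `Δ(q i j) = ∑ k, j₁(q i k) j₂(q k j)`. -/
def IsPermComult (Δ : CPerm N ω →⋆ₐ[ℂ] BraidedTensor hω R R) : Prop :=
  ∀ i j, Δ (CPerm.q ω i j) = ∑ k, j₁ hω R R (CPerm.q ω i k) * j₂ hω R R (CPerm.q ω k j)

/-- The element `z` of the bosonization. -/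
def bosonZ : Boson hω R := j₁ hω (czRep N) R (czGen ω)

/-- The elements `q i j` of the bosonization. -/
def bosonQ (i j : ZMod N) : Boson hω R := j₂ hω (czRep N) R (CPerm.q ω i j)

end PermBoson

/-- The relations between `z` and the `q i j` in the bosonization of `S_N^+(R)`. -/
structure BosonRel (ω : ℂ) {B : Type v} [Ring B] [StarRing B] [Algebra ℂ B]
    (z : B) (q : ZMod N → ZMod N → B) : Prop where
  mul_star : z * star z = 1
  star_mul : star z * z = 1
  pow_eq_one : z ^ N = 1
  comm : ∀ i j, z * q i j = rpow ω (j - i) • (q i j * z)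
  perm : PermRel ω q

/-- `C` is the universal unital C*-algebra generated by `z` and the `q i j`, subject to the
relations `BosonRel`. -/
structure IsUniversalBoson (ω : ℂ) {C : Type v} [CStarAlgebra C]
    (z : C) (q : ZMod N → ZMod N → C) : Prop where
  rel : BosonRel ω z q
  generates : generated ({z} ∪ {x | ∃ i j, x = q i j}) = ⊤
  universal : ∀ (B : Type w) [CStarAlgebra B] (z' : B) (q' : ZMod N → ZMod N → B),
    BosonRel ω z' q' → ∃! φ : C →⋆ₐ[ℂ] B, φ z = z' ∧ ∀ i j, φ (q i j) = q' i j

/-- `C`, with the unital `*`-homomorphism `ι : A → C` and the unitary `z` of order dividing `N`, is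
the crossed product of `A` by the action `α` of `ℤ/Nℤ` (the unitary `z ^ t` implements `ρ t`). -/
structure IsCrossedProduct {A : Type u} [CStarAlgebra A] (α : ZNAction N A) {C : Type v}
    [CStarAlgebra C] (ι : A →⋆ₐ[ℂ] C) (z : C) : Prop where
  mem_unitary : z ∈ unitary C
  pow_eq_one : z ^ N = 1
  covariant : ∀ a, z * ι a * star z = ι (α.ρ 1 a)
  generates : generated ({z} ∪ Set.range ι) = ⊤
  universal : ∀ (B : Type w) [CStarAlgebra B] (φ : A →⋆ₐ[ℂ] B) (v : B), v ∈ unitary B →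
    v ^ N = 1 → (∀ a, v * φ a * star v = φ (α.ρ 1 a)) →
    ∃! Φ : C →⋆ₐ[ℂ] B, Φ z = v ∧ Φ.comp ι = φ

end Boson

end

end Anyonic

open Anyonic

/-!
The dual action of `ℤ/Nℤ` on `C(ℤ/Nℤ) ⊠ A` fixes the second factor and multiplies `z` by powers of
`ω`. Averaging over it recovers the coefficients `f k` of a sum `∑ k, z ^ k * j₂ (f k)` and shows
that they are unique, whence `C(ℤ/Nℤ) ⊠ A` consists of such sums and is the crossed product of `A`
by `ℤ/Nℤ`.

The comultiplication `Δ` exists because `j₂ y * j₁ x = ω ^ (-m * n) * j₁ x * j₂ y` for `x` of degree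
`m` and `y` of degree `n`, which makes the elements `∑ k, j₁ (q i k) * j₂ (q k j)` satisfy the
relations (a)-(d) again.

On the last two factors `ψ` is spatial. Let `χ_m` be the characters of `ℤ/Nℤ` and `P_n` the
projection onto the vectors of degree `n`. Amplification along the isometries `x ↦ χ_m ⊗ U_{-m} x`
on both legs sends `j₁ a` to `j₂ a ⊗ 1` and `j₂ b = ∑ n, P_n ⊗ ρ_{-n} b` to
`∑ n, P_n ⊗ j₂ (ρ_{-n} b)`. Conjugation by the unitary `∑ t, U_t ⊗ j₁ δ_t = ∑ n, P_n ⊗ z ^ n` turns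
these elements into `∑ t, j₂ (ρ_t a) ⊗ j₁ δ_t` and `1 ⊗ j₂ b`.
-/

namespace Anyonic

noncomputable section

section Generated

variable {C : Type v} {B : Type w} [CStarAlgebra C] [CStarAlgebra B] {s : Set C}

theorem generated_le {S : StarSubalgebra ℂ C} (hs : s ⊆ S) (hS : IsClosed (S : Set C)) :
    generated s ≤ S :=
  StarSubalgebra.topologicalClosure_minimal (StarAlgebra.adjoin_le hs) hS

theorem map_mem_of_mem_generated {S : StarSubalgebra ℂ B} (hS : IsClosed (S : Set B))
    (Φ : C →⋆ₐ[ℂ] B) (h : ∀ x ∈ s, Φ x ∈ S) {x : C} (hx : x ∈ generated s) : Φ x ∈ S :=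
  generated_le (S := S.comap Φ) h (hS.preimage (continuous_hom Φ)) hx

theorem generated_preimage_val_eq_top (s : Set C) :
    generated (Subtype.val ⁻¹' s : Set (generated s)) = ⊤ := by
  have hclosed : IsClosed (((generated (Subtype.val ⁻¹' s)).map (generated s).subtype :
      StarSubalgebra ℂ C) : Set C) :=
    (isClosed_generated s).isClosedEmbedding_subtypeVal.isClosedMap _ (isClosed_generated _)
  have hle : generated s ≤ (generated (Subtype.val ⁻¹' s)).map (generated s).subtype :=
    generated_le (fun x hx => ⟨⟨x, subset_generated hx⟩, subset_generated hx, rfl⟩) hclosed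
  refine eq_top_iff.2 fun x _ => ?_
  obtain ⟨y, hy, hyx⟩ := hle x.2
  exact Subtype.ext hyx ▸ hy

theorem hom_ext_of_generated_eq_top (hs : generated s = ⊤) {Φ Ψ : C →⋆ₐ[ℂ] B}
    (h : ∀ x ∈ s, Φ x = Ψ x) : Φ = Ψ := by
  have hle : generated s ≤ StarAlgHom.equalizer Φ Ψ :=
    generated_le h (isClosed_eq (continuous_hom Φ) (continuous_hom Ψ))
  exact StarAlgHom.ext fun x => hle (hs ▸ StarSubalgebra.mem_top)

end Generated

section CrossedProduct

variable {N : ℕ} {ω : ℂ}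

section RootsOfUnity

variable [NeZero N]

theorem rpow_pow_val (hω : IsPrimitiveRoot ω N) (t k : ZMod N) :
    rpow ω t ^ k.val = rpow ω (t * k) := by
  have h := rpow_natCast hω (t.val * k.val)
  rw [Nat.cast_mul, ZMod.natCast_zmod_val, ZMod.natCast_zmod_val] at h
  rw [h, rpow, pow_mul]

theorem norm_rpow (hω : IsPrimitiveRoot ω N) (a : ZMod N) : ‖rpow ω a‖ = 1 := by
  rw [rpow, norm_pow, hω.norm'_eq_one (NeZero.ne N), one_pow]

theorem sum_rpow_neg_smul_sum_rpow_smul (hω : IsPrimitiveRoot ω N) {E : Type*} [AddCommGroup E]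
    [Module ℂ E] (x : ZMod N → E) (k : ZMod N) :
    ∑ t, rpow ω (-(t * k)) • ∑ j, rpow ω (t * j) • x j = (N : ℂ) • x k := by
  have hexp : ∀ j t : ZMod N, -(t * k) + t * j = t * (j - k) := fun j t => by ring
  simp only [Finset.smul_sum, smul_smul, ← rpow_add hω, hexp]
  rw [Finset.sum_comm]
  simp only [← Finset.sum_smul, sum_rpow hω, sub_eq_zero, ite_smul, zero_smul,
    Finset.sum_ite_eq', Finset.mem_univ, if_true]

end RootsOfUnity

section Powers

variable {B : Type*} [Ring B] {v : B}

theorem pow_val_one (hN : v ^ N = 1) : v ^ (1 : ZMod N).val = v := by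
  rw [ZMod.val_one_eq_one_mod, ← pow_eq_pow_mod _ hN, pow_one]

theorem pow_val_zero : v ^ (0 : ZMod N).val = 1 := by
  rw [ZMod.val_zero, pow_zero]

variable [NeZero N]

theorem pow_val_add (hN : v ^ N = 1) (k l : ZMod N) :
    v ^ (k + l).val = v ^ k.val * v ^ l.val := by
  rw [ZMod.val_add, ← pow_add]
  exact (pow_eq_pow_mod _ hN).symm

theorem star_pow_val [StarRing B] (hv : v ∈ unitary B) (hN : v ^ N = 1) (k : ZMod N) :
    star (v ^ k.val) = v ^ (-k).val := by
  have hleft : star (v ^ k.val) * v ^ k.val = 1 :=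
    Unitary.star_mul_self_of_mem (pow_mem hv _)
  have hright : v ^ k.val * v ^ (-k).val = 1 := by
    rw [← pow_val_add hN, add_neg_cancel, pow_val_zero]
  exact left_inv_eq_right_inv hleft hright

end Powers

variable {A : Type u} [CStarAlgebra A] {α : ZNAction N A}

/-- A covariant pair for an action `α` of `ℤ/Nℤ`: a `*`-homomorphism `φ` and a unitary `v` with
`v ^ N = 1` that implements the generator of `α`. These are the pairs that the crossed product
by `α` classifies; the target is only a `*`-algebra, so that pairs can be formed in products. -/
structure CovPair {B : Type*} [Ring B] [StarRing B] [Algebra ℂ B]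
    (α : ZNAction N A) (φ : A →⋆ₐ[ℂ] B) (v : B) : Prop where
  mem_unitary : v ∈ unitary B
  pow_eq_one : v ^ N = 1
  covariant : ∀ a, v * φ a * star v = φ (α.ρ 1 a)

namespace CovPair

variable {B : Type*} [Ring B] [StarRing B] [Algebra ℂ B] {φ : A →⋆ₐ[ℂ] B} {v : B}

theorem mul_eq (h : CovPair α φ v) (a : A) : v * φ a = φ (α.ρ 1 a) * v := by
  rw [← h.covariant, mul_assoc _ (star v), Unitary.star_mul_self_of_mem h.mem_unitary, mul_one]

theorem prod {B' : Type*} [Ring B'] [StarRing B'] [Algebra ℂ B'] {φ' : A →⋆ₐ[ℂ] B'} {v' : B'}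
    (h : CovPair α φ v) (h' : CovPair α φ' v') : CovPair α (φ.prod φ') (v, v') where
  mem_unitary := Unitary.mem_iff.2
    ⟨Prod.ext (Unitary.star_mul_self_of_mem h.mem_unitary)
        (Unitary.star_mul_self_of_mem h'.mem_unitary),
      Prod.ext (Unitary.mul_star_self_of_mem h.mem_unitary)
        (Unitary.mul_star_self_of_mem h'.mem_unitary)⟩
  pow_eq_one := Prod.ext h.pow_eq_one h'.pow_eq_one
  covariant a := Prod.ext (h.covariant a) (h'.covariant a)

theorem of_generated_eq_top {B : Type*} [CStarAlgebra B] {φ : A →⋆ₐ[ℂ] B} {v : B} {s : Set A}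
    (hs : generated s = ⊤) (hv : v ∈ unitary B) (hN : v ^ N = 1)
    (h : ∀ a ∈ s, v * φ a = φ (α.ρ 1 a) * v) : CovPair α φ v where
  mem_unitary := hv
  pow_eq_one := hN
  covariant a := by
    let u : unitary B := ⟨v, hv⟩
    have hconj : ((Unitary.conjStarAlgAut ℂ B u : B ≃⋆ₐ[ℂ] B) : B →⋆ₐ[ℂ] B).comp φ =
        φ.comp (α.ρ 1) :=
      hom_ext_of_generated_eq_top hs fun a ha => by
        change v * φ a * star v = φ (α.ρ 1 a)
        rw [h a ha, mul_assoc, Unitary.mul_star_self_of_mem hv, mul_one]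
    exact DFunLike.congr_fun hconj a

variable [NeZero N]

theorem pow_mul_eq (h : CovPair α φ v) (k : ZMod N) (a : A) :
    v ^ k.val * φ a = φ (α.ρ k a) * v ^ k.val := by
  have hpow : ∀ n : ℕ, v ^ n * φ a = φ (α.ρ n a) * v ^ n := by
    intro n
    induction n with
    | zero => simp [α.ρ_zero]
    | succ n ih =>
      rw [pow_succ', mul_assoc, ih, ← mul_assoc, h.mul_eq, ← α.ρ_add, mul_assoc, Nat.cast_succ,
        add_comm]
  simpa using hpow k.val

theorem mul_pow_eq (h : CovPair α φ v) (k : ZMod N) (a : A) :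
    φ a * v ^ k.val = v ^ k.val * φ (α.ρ (-k) a) := by
  rw [h.pow_mul_eq, ← α.ρ_add, add_neg_cancel, α.ρ_zero]

end CovPair

variable [NeZero N]

/-- The element `∑ k, v ^ k * φ (f k)` attached to a pair `(φ, v)`: the integrated form of a
covariant pair, where `f` runs through the functions from `ℤ/Nℤ` to the algebra acted upon. -/
def covSum {B : Type*} [Ring B] [StarRing B] [Algebra ℂ B] (φ : A →⋆ₐ[ℂ] B) (v : B) :
    (ZMod N → A) →ₗ[ℂ] B where
  toFun f := ∑ k, v ^ k.val * φ (f k)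
  map_add' f g := by simp [mul_add, Finset.sum_add_distrib]
  map_smul' c f := by simp [Finset.smul_sum]

section CovSum

variable {B : Type*} [Ring B] [StarRing B] [Algebra ℂ B] {φ : A →⋆ₐ[ℂ] B} {v : B}

theorem covSum_apply (f : ZMod N → A) : covSum φ v f = ∑ k, v ^ k.val * φ (f k) := rfl

theorem covSum_single (k : ZMod N) (a : A) : covSum φ v (Pi.single k a) = v ^ k.val * φ a := by
  rw [covSum_apply, Finset.sum_eq_single k]
  · simp
  · intro l _ hl
    simp [hl]
  · simp

theorem pow_mul_mem_range_covSum (k : ZMod N) (a : A) :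
    v ^ k.val * φ a ∈ LinearMap.range (covSum (N := N) φ v) :=
  ⟨_, covSum_single k a⟩

theorem algebraMap_mem_range_covSum (c : ℂ) :
    algebraMap ℂ B c ∈ LinearMap.range (covSum (N := N) φ v) := by
  have hc := pow_mul_mem_range_covSum (N := N) (φ := φ) (v := v) 0 (algebraMap ℂ A c)
  rwa [pow_val_zero, one_mul, AlgHomClass.commutes] at hc

end CovSum

namespace CovPair

variable {B : Type*} [Ring B] [StarRing B] [Algebra ℂ B] {φ : A →⋆ₐ[ℂ] B} {v : B}

theorem covSum_mul_covSum_mem (h : CovPair α φ v) (f g : ZMod N → A) :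
    covSum φ v f * covSum φ v g ∈ LinearMap.range (covSum (N := N) φ v) := by
  rw [covSum_apply, covSum_apply, Finset.sum_mul_sum]
  refine Submodule.sum_mem _ fun k _ => Submodule.sum_mem _ fun l _ => ?_
  have hkl : v ^ k.val * φ (f k) * (v ^ l.val * φ (g l)) =
      v ^ (k + l).val * φ (α.ρ (-l) (f k) * g l) := by
    rw [mul_assoc, ← mul_assoc (φ (f k)), h.mul_pow_eq, pow_val_add h.pow_eq_one, map_mul]
    simp only [mul_assoc]
  exact hkl ▸ pow_mul_mem_range_covSum _ _

theorem star_covSum_mem (h : CovPair α φ v) (f : ZMod N → A) :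
    star (covSum φ v f) ∈ LinearMap.range (covSum (N := N) φ v) := by
  rw [covSum_apply, star_sum]
  refine Submodule.sum_mem _ fun k _ => ?_
  rw [star_mul, star_pow_val h.mem_unitary h.pow_eq_one, ← map_star, h.mul_pow_eq]
  exact pow_mul_mem_range_covSum _ _

variable [StarModule ℂ B]

/-- The `*`-subalgebra of all `∑ k, v ^ k * φ (f k)` for a covariant pair `(φ, v)`; it is the
`*`-algebra that `φ` and `v` generate. -/
def range (h : CovPair α φ v) : StarSubalgebra ℂ B where
  carrier := LinearMap.range (covSum (N := N) φ v)
  mul_mem' := by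
    rintro _ _ ⟨f, rfl⟩ ⟨g, rfl⟩
    exact h.covSum_mul_covSum_mem f g
  add_mem' := Submodule.add_mem _
  algebraMap_mem' := algebraMap_mem_range_covSum
  star_mem' := by
    rintro _ ⟨f, rfl⟩
    exact h.star_covSum_mem f

theorem mem_range (h : CovPair α φ v) : v ∈ h.range :=
  ⟨Pi.single 1 1, by rw [covSum_single, map_one, mul_one, pow_val_one h.pow_eq_one]⟩

theorem apply_mem_range (h : CovPair α φ v) (a : A) : φ a ∈ h.range :=
  ⟨Pi.single 0 a, by rw [covSum_single, pow_val_zero, one_mul]⟩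

theorem exists_hom {C : Type*} [Ring C] [StarRing C] [Algebra ℂ C] [StarModule ℂ C]
    {ι : A →⋆ₐ[ℂ] C} {z : C}
    (h : CovPair α ι z) (hbij : Function.Bijective (covSum (N := N) ι z)) (h' : CovPair α φ v) :
    ∃ Φ : C →⋆ₐ[ℂ] B, Φ z = v ∧ Φ.comp ι = φ := by
  -- The range of the product pair is the graph of the homomorphism.
  let graph : StarSubalgebra ℂ (C × B) := (h.prod h').range
  have hfst : ∀ f, (covSum (ι.prod φ) (z, v) f).1 = covSum (N := N) ι z f := fun f => by
    simp only [covSum_apply, Prod.fst_sum]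
    rfl
  let p : graph →⋆ₐ[ℂ] C := (StarAlgHom.fst ℂ C B).comp graph.subtype
  have hp : Function.Bijective p := by
    refine ⟨?_, fun x => ?_⟩
    · rintro ⟨_, f, rfl⟩ ⟨_, g, rfl⟩ hfg
      have hfg' : covSum (N := N) ι z f = covSum ι z g := by rw [← hfst, ← hfst]; exact hfg
      exact Subtype.ext (congrArg (covSum _ _) (hbij.1 hfg'))
    · obtain ⟨f, rfl⟩ := hbij.2 x
      exact ⟨⟨_, f, rfl⟩, hfst f⟩
  let e := StarAlgEquiv.ofBijective p hp
  let Φ : C →⋆ₐ[ℂ] B := ((StarAlgHom.snd ℂ C B).comp graph.subtype).comp (e.symm : C →⋆ₐ[ℂ] graph)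
  have hΦ : ∀ x : graph, Φ x.1.1 = x.1.2 := fun x =>
    congrArg (fun y : graph => y.1.2) (e.symm_apply_apply x)
  exact ⟨Φ, hΦ ⟨_, (h.prod h').mem_range⟩,
    StarAlgHom.ext fun a => hΦ ⟨_, (h.prod h').apply_mem_range a⟩⟩

end CovPair

section Dual

variable {C : Type v} [CStarAlgebra C] {ι : A →⋆ₐ[ℂ] C} {z : C}

theorem dual_covSum (hω : IsPrimitiveRoot ω N) {Θ : C →⋆ₐ[ℂ] C} {t : ZMod N}
    (hz : Θ z = rpow ω t • z) (hι : ∀ a, Θ (ι a) = ι a) (f : ZMod N → A) :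
    Θ (covSum ι z f) = ∑ k, rpow ω (t * k) • (z ^ k.val * ι (f k)) := by
  rw [covSum_apply, map_sum]
  refine Finset.sum_congr rfl fun k _ => ?_
  rw [map_mul, map_pow, hz, hι, smul_pow, rpow_pow_val hω, smul_mul_assoc]

theorem norm_le_norm_covSum (hω : IsPrimitiveRoot ω N) (hu : z ∈ unitary C)
    (hinj : Function.Injective ι) {θ : ZMod N → C →⋆ₐ[ℂ] C}
    (hz : ∀ t, θ t z = rpow ω t • z) (hι : ∀ t a, θ t (ι a) = ι a) (f : ZMod N → A) :
    ‖f‖ ≤ ‖covSum ι z f‖ := by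
  refine (pi_norm_le_iff_of_nonneg (norm_nonneg _)).2 fun k => ?_
  have hN : (0 : ℝ) < N := Nat.cast_pos.2 (NeZero.pos N)
  have hcoeff : (N : ℂ) • (z ^ k.val * ι (f k)) =
      ∑ t, rpow ω (-(t * k)) • θ t (covSum ι z f) := by
    simp only [dual_covSum hω (hz _) (hι _), sum_rpow_neg_smul_sum_rpow_smul hω]
  refine le_of_mul_le_mul_left ?_ hN
  calc (N : ℝ) * ‖f k‖ = ‖(N : ℂ) • (z ^ k.val * ι (f k))‖ := by
        rw [norm_smul, Complex.norm_natCast, CStarRing.norm_mem_unitary_mul _ (pow_mem hu _),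
          NonUnitalStarAlgHom.norm_map ι hinj]
    _ ≤ ∑ _t : ZMod N, ‖covSum ι z f‖ := by
        rw [hcoeff]
        refine norm_sum_le_of_le _ fun t _ => ?_
        rw [norm_smul, norm_rpow hω, one_mul]
        exact NonUnitalStarAlgHom.norm_apply_le (θ t) _
    _ = N * ‖covSum ι z f‖ := by simp

theorem continuous_covSum : Continuous (covSum (N := N) ι z) := by
  have hι := continuous_hom ι
  change Continuous fun f : ZMod N → A => ∑ k, z ^ k.val * ι (f k)
  fun_prop

theorem covSum_bijective (hω : IsPrimitiveRoot ω N) (h : CovPair α ι z)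
    (hinj : Function.Injective ι) (hgen : generated ({z} ∪ Set.range ι) = ⊤)
    {θ : ZMod N → C →⋆ₐ[ℂ] C}
    (hz : ∀ t, θ t z = rpow ω t • z) (hι : ∀ t a, θ t (ι a) = ι a) :
    Function.Bijective (covSum (N := N) ι z) := by
  have hanti : AntilipschitzWith 1 (covSum (N := N) ι z) :=
    AddMonoidHomClass.antilipschitz_of_bound _ fun f => by
      simpa using norm_le_norm_covSum hω h.mem_unitary hinj hz hι f
  have hclosed : IsClosed (h.range : Set C) :=
    hanti.isClosed_range (uniformContinuous_addMonoidHom_of_continuous continuous_covSum)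
  have hle : generated ({z} ∪ Set.range ι) ≤ h.range := by
    refine generated_le ?_ hclosed
    rintro _ (rfl | ⟨a, rfl⟩)
    exacts [h.mem_range, h.apply_mem_range a]
  exact ⟨hanti.injective, fun x => hle (hgen ▸ StarSubalgebra.mem_top)⟩

theorem isCrossedProduct_of_dual (hω : IsPrimitiveRoot ω N) (h : CovPair α ι z)
    (hinj : Function.Injective ι) (hgen : generated ({z} ∪ Set.range ι) = ⊤)
    {θ : ZMod N → C →⋆ₐ[ℂ] C}
    (hz : ∀ t, θ t z = rpow ω t • z) (hι : ∀ t a, θ t (ι a) = ι a) :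
    IsCrossedProduct.{_, _, w} α ι z where
  mem_unitary := h.mem_unitary
  pow_eq_one := h.pow_eq_one
  covariant := h.covariant
  generates := hgen
  universal B _ φ v hv hvN hcov := by
    obtain ⟨Φ, hΦz, hΦι⟩ := h.exists_hom (covSum_bijective hω h hinj hgen hz hι) ⟨hv, hvN, hcov⟩
    refine ⟨Φ, ⟨hΦz, hΦι⟩, fun Ψ ⟨hΨz, hΨι⟩ => hom_ext_of_generated_eq_top hgen ?_⟩
    rintro _ (rfl | ⟨a, rfl⟩)
    · rw [hΨz, hΦz]
    · exact DFunLike.congr_fun (hΨι.trans hΦι.symm) a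

end Dual

end CrossedProduct

section TensorOperators

variable {H : Type*} [NormedAddCommGroup H] [InnerProductSpace ℂ H]
variable {K : Type*} [NormedAddCommGroup K] [InnerProductSpace ℂ K]
variable {H' : Type*} [NormedAddCommGroup H'] [InnerProductSpace ℂ H']
variable {K' : Type*} [NormedAddCommGroup K'] [InnerProductSpace ℂ K']
variable {ι : Type*}

theorem norm_elem (x : H) (y : K) : ‖elem x y‖ = ‖x‖ * ‖y‖ :=
  (Completion.norm_coe _).trans (TensorProduct.norm_tmul x y)

theorem opT_add_left (X X' : H →L[ℂ] H') (Y : K →L[ℂ] K') :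
    opT (X + X') Y = opT X Y + opT X' Y :=
  ext_elem fun a b => by simp [opT_elem, elem_add_left]

theorem opT_add_right (X : H →L[ℂ] H') (Y Y' : K →L[ℂ] K') :
    opT X (Y + Y') = opT X Y + opT X Y' :=
  ext_elem fun a b => by simp [opT_elem, elem_add_right]

theorem opT_smul_left (c : ℂ) (X : H →L[ℂ] H') (Y : K →L[ℂ] K') :
    opT (c • X) Y = c • opT X Y :=
  ext_elem fun a b => by simp [opT_elem, elem_smul_left]

theorem opT_smul_right (c : ℂ) (X : H →L[ℂ] H') (Y : K →L[ℂ] K') :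
    opT X (c • Y) = c • opT X Y :=
  ext_elem fun a b => by simp [opT_elem, elem_smul_right]

/-- The tensor product of bounded operators as a bilinear map. -/
def opTBilin : (H →L[ℂ] H') →ₗ[ℂ] (K →L[ℂ] K') →ₗ[ℂ] HTensor H K →L[ℂ] HTensor H' K' :=
  LinearMap.mk₂ ℂ opT opT_add_left opT_smul_left opT_add_right opT_smul_right

theorem opT_zero_left (Y : K →L[ℂ] K') : opT (0 : H →L[ℂ] H') Y = 0 :=
  opTBilin.map_zero₂ Y

theorem opT_zero_right (X : H →L[ℂ] H') : opT X (0 : K →L[ℂ] K') = 0 :=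
  map_zero (opTBilin X)

theorem opT_sum_left (s : Finset ι) (X : ι → H →L[ℂ] H') (Y : K →L[ℂ] K') :
    opT (∑ i ∈ s, X i) Y = ∑ i ∈ s, opT (X i) Y :=
  opTBilin.map_sum₂ s X Y

theorem opT_sum_right (s : Finset ι) (X : H →L[ℂ] H') (Y : ι → K →L[ℂ] K') :
    opT X (∑ i ∈ s, Y i) = ∑ i ∈ s, opT X (Y i) :=
  map_sum (opTBilin X) Y s

theorem elem_eq_zero {x : H} {y : K} : elem x y = 0 ↔ x = 0 ∨ y = 0 := by
  rw [← norm_eq_zero, norm_elem, mul_eq_zero, norm_eq_zero, norm_eq_zero]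

theorem opT_comp {H'' K'' : Type*} [NormedAddCommGroup H''] [InnerProductSpace ℂ H'']
    [NormedAddCommGroup K''] [InnerProductSpace ℂ K''] (S : H' →L[ℂ] H'') (T : K' →L[ℂ] K'')
    (S' : H →L[ℂ] H') (T' : K →L[ℂ] K') : opT S T ∘L opT S' T' = opT (S ∘L S') (T ∘L T') :=
  ext_elem fun a b => by simp [opT_elem]

/-- The operator `y ↦ x ⊗ y`. -/
def ins (x : H) : K →L[ℂ] HTensor H K :=
  LinearMap.mkContinuous
    { toFun := fun y => elem x y
      map_add' := elem_add_right x
      map_smul' := fun c y => elem_smul_right c x y } ‖x‖ fun y => (norm_elem x y).le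

theorem ins_apply (x : H) (y : K) : ins x y = elem x y := rfl

end TensorOperators

section Degree

variable {N : ℕ} [NeZero N] {ω : ℂ}
variable {H : Type u} [NormedAddCommGroup H] [InnerProductSpace ℂ H] [CompleteSpace H]
variable {K : Type v} [NormedAddCommGroup K] [InnerProductSpace ℂ K]

/-- A vector `x` is homogeneous of degree `m` for a unitary representation `U` of `ℤ/Nℤ` if
`U t x = ω ^ (t * m) • x` for all `t`. -/
def HasDegree (ω : ℂ) (U : Multiplicative (ZMod N) →* unitary (H →L[ℂ] H)) (m : ZMod N)
    (x : H) : Prop :=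
  ∀ t, (U (.ofAdd t) : H →L[ℂ] H) x = rpow ω (t * m) • x

variable {U : Multiplicative (ZMod N) →* unitary (H →L[ℂ] H)}

theorem hasDegree_degProj (hω : IsPrimitiveRoot ω N) (m : ZMod N) (x : H) :
    HasDegree ω U m (degProj ω U m x) := fun t => by
  rw [← mul_apply_eq_comp, U_mul_degProj hω, smul_apply]

theorem HasDegree.degProj_apply (hω : IsPrimitiveRoot ω N) {m : ZMod N} {x : H}
    (hx : HasDegree ω U m x) (n : ZMod N) :
    degProj ω U n x = if n = m then x else 0 := by
  have hexp : ∀ t : ZMod N, -(t * n) + t * m = t * (m - n) := fun t => by ring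
  simp only [degProj, smul_apply, sum_apply, hx _, smul_smul, ← rpow_add hω, hexp,
    ← Finset.sum_smul, sum_rpow hω, sub_eq_zero, eq_comm (a := m)]
  split_ifs <;> simp [NeZero.ne N]

theorem sum_rpow_smul_degProj (hω : IsPrimitiveRoot ω N)
    (U : Multiplicative (ZMod N) →* unitary (H →L[ℂ] H)) (t : ZMod N) :
    ∑ m, rpow ω (t * m) • degProj ω U m = (U (.ofAdd t) : H →L[ℂ] H) := by
  simp only [← U_mul_degProj hω, ← Finset.mul_sum, sum_degProj hω, mul_one]

theorem sum_elem_degProj (hω : IsPrimitiveRoot ω N)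
    (U : Multiplicative (ZMod N) →* unitary (H →L[ℂ] H)) (x : H) (y : K) :
    ∑ m, elem (degProj ω U m x) y = elem x y := by
  rw [← elem_sum_left, sum_degProj_apply hω]

variable [CompleteSpace K]

theorem HasDegree.braiding_elem (hω : IsPrimitiveRoot ω N) {m : ZMod N} {x : H}
    (hx : HasDegree ω U m x)
    (V : Multiplicative (ZMod N) →* unitary (K →L[ℂ] K)) (y : K) :
    braiding ω U V (elem x y) = elem ((V (.ofAdd m) : K →L[ℂ] K) y) x := by
  simp only [Anyonic.braiding_elem, hx.degProj_apply hω, elem_ite, smul_ite, smul_zero]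
  rw [Finset.sum_comm]
  simp only [Finset.sum_ite_eq', Finset.mem_univ, if_true, ← elem_smul_left, ← elem_sum_left]
  simp only [← sum_rpow_smul_degProj hω V m, sum_apply, smul_apply]

theorem HasDegree.braidingDual_elem (hω : IsPrimitiveRoot ω N) {m : ZMod N} {x : H}
    (hx : HasDegree ω U m x)
    (V : Multiplicative (ZMod N) →* unitary (K →L[ℂ] K)) (y : K) :
    braidingDual ω U V (elem y x) = elem x ((V (.ofAdd (-m)) : K →L[ℂ] K) y) := by
  simp only [Anyonic.braidingDual_elem, hx.degProj_apply hω, ite_elem, smul_ite, smul_zero]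
  rw [Finset.sum_comm]
  simp only [Finset.sum_ite_eq', Finset.mem_univ, if_true, ← elem_smul_right, ← elem_sum_right]
  simp only [← sum_rpow_smul_degProj hω V (-m), sum_apply, smul_apply, neg_mul]

end Degree

section BraidedTensor

variable {N : ℕ} {ω : ℂ}
variable {H : Type u} [NormedAddCommGroup H] [InnerProductSpace ℂ H] [CompleteSpace H]
variable {K : Type v} [NormedAddCommGroup K] [InnerProductSpace ℂ K] [CompleteSpace K]
variable {A : Type*} [CStarAlgebra A] {α : ZNAction N A}
variable {B : Type*} [CStarAlgebra B] {β : ZNAction N B}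

theorem CovRep.U_mul_π (R : CovRep α H) (t : ZMod N) (a : A) :
    (R.U (.ofAdd t) : H →L[ℂ] H) * R.π a = R.π (α.ρ t a) * (R.U (.ofAdd t) : H →L[ℂ] H) := by
  rw [R.covariant, mul_assoc, Unitary.star_mul_self_of_mem (R.U (.ofAdd t)).2, mul_one]

theorem conj_eq_of_mul_eq {u : unitary (H →L[ℂ] H)} {x y : H →L[ℂ] H}
    (h : (u : H →L[ℂ] H) * x = y * u) : conj u x = y := by
  rw [conj_apply, h, mul_assoc, Unitary.mul_star_self_of_mem u.2, mul_one]

theorem conj_tensorU_one_leg1 (R : CovRep α H) (t : ZMod N) (a : A) :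
    conj (tensorU R.U (1 : Multiplicative (ZMod N) →* unitary (K →L[ℂ] K)) (.ofAdd t))
      (leg1 (K := K) R a) = leg1 R (α.ρ t a) :=
  conj_eq_of_mul_eq <| by
    change opT _ 1 * opT (R.π a) 1 = opT (R.π (α.ρ t a)) 1 * opT _ 1
    rw [opT_mul, opT_mul, R.U_mul_π]

variable [NeZero N]

theorem CovRep.π_mul_degProj (hω : IsPrimitiveRoot ω N) (R : CovRep α H) {d : ZMod N} {a : A}
    (ha : ∀ t, α.ρ t a = rpow ω (t * d) • a) (m : ZMod N) :
    R.π a * degProj ω R.U m = degProj ω R.U (m + d) * R.π a := by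
  simp only [degProj, mul_smul_comm, smul_mul_assoc, Finset.mul_sum, Finset.sum_mul, R.U_mul_π, ha,
    map_smul, smul_smul, ← rpow_add hω]
  congr 1
  refine Finset.sum_congr rfl fun t _ => ?_
  congr 2
  ring_nf

variable (hω : IsPrimitiveRoot ω N) (R : CovRep α H) (S : CovRep β K)

theorem leg2_elem {m : ZMod N} {x : H} (hx : HasDegree ω R.U m x) (b : B) (y : K) :
    leg2 hω R S b (elem x y) = elem x (S.π (β.ρ (-m) b) y) := by
  change braidingDual ω R.U S.U (opT (S.π b) 1 (braiding ω R.U S.U (elem x y))) = _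
  rw [hx.braiding_elem hω, opT_elem, one_apply_eq_self, hx.braidingDual_elem hω,
    S.covariant, star_U, neg_neg]
  rfl

theorem leg2_apply (b : B) :
    leg2 hω R S b = ∑ m, opT (degProj ω R.U m) (S.π (β.ρ (-m) b)) := by
  refine ext_elem fun x y => ?_
  conv_lhs => rw [← sum_elem_degProj hω R.U x y]
  rw [map_sum, sum_apply]
  refine Finset.sum_congr rfl fun m _ => ?_
  rw [leg2_elem hω R S (hasDegree_degProj hω m x), opT_elem]

theorem j₂_injective [Nontrivial H] : Function.Injective (j₂ hω R S) := by
  refine (injective_iff_map_eq_zero _).2 fun b hb => ?_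
  obtain ⟨x, hx⟩ := exists_ne (0 : H)
  obtain ⟨m, hm⟩ : ∃ m, degProj ω R.U m x ≠ 0 := by
    by_contra! h
    exact hx ((sum_degProj_apply hω R.U x).symm.trans (Finset.sum_eq_zero fun m _ => h m))
  have hzero : S.π (β.ρ (-m) b) = 0 := ContinuousLinearMap.ext fun y => by
    have h := leg2_elem hω R S (hasDegree_degProj hω m x) b y
    rw [show leg2 hω R S b = 0 from congrArg Subtype.val hb] at h
    exact (elem_eq_zero.1 h.symm).resolve_left hm
  have hb' : β.ρ (-m) b = 0 := S.faithful (hzero.trans (map_zero _).symm)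
  rw [← β.ρ_zero b, ← add_neg_cancel m, β.ρ_add, hb', map_zero]

theorem opT_U_mul_leg2 (t : ZMod N) (b : B) :
    opT (R.U (.ofAdd t) : H →L[ℂ] H) 1 * leg2 hω R S b =
      leg2 hω R S b * opT (R.U (.ofAdd t) : H →L[ℂ] H) 1 := by
  have hP : ∀ m, (R.U (.ofAdd t) : H →L[ℂ] H) * degProj ω R.U m =
      degProj ω R.U m * (R.U (.ofAdd t) : H →L[ℂ] H) := fun m =>
    ContinuousLinearMap.ext fun x => (degProj_U R.U m t x).symm
  simp only [leg2_apply, Finset.mul_sum, Finset.sum_mul, opT_mul, hP, one_mul, mul_one]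

theorem opT_one_U_mul_leg2 (t : ZMod N) (b : B) :
    opT 1 (S.U (.ofAdd t) : K →L[ℂ] K) * leg2 hω R S b =
      leg2 hω R S (β.ρ t b) * opT 1 (S.U (.ofAdd t) : K →L[ℂ] K) := by
  simp only [leg2_apply, Finset.mul_sum, Finset.sum_mul, opT_mul, S.U_mul_π, one_mul, mul_one,
    ← β.ρ_add, add_comm t]

theorem leg1_mul_leg2 {d : ZMod N} {a : A} (ha : ∀ t, α.ρ t a = rpow ω (t * d) • a) (b : B) :
    leg1 R a * leg2 hω R S b = leg2 hω R S (β.ρ d b) * leg1 R a := by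
  change opT (R.π a) 1 * _ = _ * opT (R.π a) 1
  simp only [leg2_apply, Finset.mul_sum, Finset.sum_mul, opT_mul, R.π_mul_degProj hω ha, one_mul,
    mul_one, ← β.ρ_add]
  refine Fintype.sum_equiv (Equiv.addRight d) _ _ fun m => ?_
  rw [Equiv.coe_addRight, neg_add, neg_add_cancel_right]

theorem j₁_mul_j₂ {d : ZMod N} {a : A} (ha : ∀ t, α.ρ t a = rpow ω (t * d) • a) (b : B) :
    j₁ hω R S a * j₂ hω R S b = j₂ hω R S (β.ρ d b) * j₁ hω R S a :=
  Subtype.ext (leg1_mul_leg2 hω R S ha b)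

theorem j₂_mul_j₁ {d e : ZMod N} {a : A} {b : B} (ha : ∀ t, α.ρ t a = rpow ω (t * d) • a)
    (hb : ∀ t, β.ρ t b = rpow ω (t * e) • b) :
    j₂ hω R S b * j₁ hω R S a = rpow ω (-(d * e)) • (j₁ hω R S a * j₂ hω R S b) := by
  rw [j₁_mul_j₂ hω R S ha, hb, map_smul, smul_mul_assoc, smul_smul, rpow_neg_mul hω, one_smul]

theorem covPair_j₂ {u : A} (hu : u ∈ unitary A) (huN : u ^ N = 1)
    (hdeg : ∀ t, α.ρ t u = rpow ω t • u) : CovPair β (j₂ hω R S) (j₁ hω R S u) where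
  mem_unitary := Unitary.map_mem _ hu
  pow_eq_one := by rw [← map_pow, huN, map_one]
  covariant b := by
    rw [j₁_mul_j₂ hω R S (d := 1) (by simpa using hdeg), mul_assoc,
      Unitary.mul_star_self_of_mem (Unitary.map_mem _ hu), mul_one]

theorem braidedAction_j₁ (t : ZMod N) (a : A) :
    (braidedAction hω R S).ρ t (j₁ hω R S a) = j₁ hω R S (α.ρ t a) :=
  Subtype.ext (conj_leg1 R S t a)

theorem braidedAction_j₂ (t : ZMod N) (b : B) :
    (braidedAction hω R S).ρ t (j₂ hω R S b) = j₂ hω R S (β.ρ t b) :=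
  Subtype.ext (conj_leg2 hω R S t b)

theorem generated_j₁_j₂ :
    generated (Set.range (j₁ hω R S) ∪ Set.range (j₂ hω R S)) = ⊤ := by
  refine eq_top_iff.2 ((generated_preimage_val_eq_top _).symm.le.trans
    (generated_le ?_ (isClosed_generated _)))
  rintro x ⟨a, b, hx⟩
  have hx' : x = j₁ hω R S a * j₂ hω R S b := Subtype.ext hx
  exact hx' ▸ mul_mem (subset_generated (Or.inl ⟨a, rfl⟩)) (subset_generated (Or.inr ⟨b, rfl⟩))

theorem conj_tensorU_one_leg2 (t : ZMod N) (b : B) :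
    conj (tensorU R.U (1 : Multiplicative (ZMod N) →* unitary (K →L[ℂ] K)) (.ofAdd t))
      (leg2 hω R S b) = leg2 hω R S b :=
  conj_eq_of_mul_eq (opT_U_mul_leg2 hω R S t b)

theorem conj_tensorU_one_mem (t : ZMod N) {T : HTensor H K →L[ℂ] HTensor H K}
    (hT : T ∈ braided hω R S) :
    conj (tensorU R.U (1 : Multiplicative (ZMod N) →* unitary (K →L[ℂ] K)) (.ofAdd t)) T ∈
      braided hω R S := by
  refine map_mem_of_mem_generated (isClosed_generated _) _ ?_ hT
  rintro _ ⟨a, b, rfl⟩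
  rw [map_mul, conj_tensorU_one_leg1, conj_tensorU_one_leg2]
  exact leg_mul_leg_mem hω R S _ _

/-- The action of `ℤ/Nℤ` on the braided tensor product that moves the first factor only. For the
bosonization it is the dual action of the crossed product. -/
def leftAction (t : ZMod N) : BraidedTensor hω R S →⋆ₐ[ℂ] BraidedTensor hω R S :=
  ((conj (tensorU R.U (1 : Multiplicative (ZMod N) →* unitary (K →L[ℂ] K)) (.ofAdd t))).comp
    (braided hω R S).subtype).codRestrict (braided hω R S) fun T =>
      conj_tensorU_one_mem hω R S t T.2

theorem leftAction_j₁ (t : ZMod N) (a : A) :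
    leftAction hω R S t (j₁ hω R S a) = j₁ hω R S (α.ρ t a) :=
  Subtype.ext (conj_tensorU_one_leg1 R t a)

theorem leftAction_j₂ (t : ZMod N) (b : B) :
    leftAction hω R S t (j₂ hω R S b) = j₂ hω R S b :=
  Subtype.ext (conj_tensorU_one_leg2 hω R S t b)

end BraidedTensor

section CyclicGroup

variable {N : ℕ} {ω : ℂ}

theorem czGen_pow_eq_one (hω : IsPrimitiveRoot ω N) : (czGen ω : CZ N) ^ N = 1 := by
  funext s
  rw [Pi.pow_apply, czGen, rpow, pow_right_comm, hω.pow_eq_one, one_pow, Pi.one_apply]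

variable [NeZero N]

theorem czGen_pow_apply (hω : IsPrimitiveRoot ω N) (k t : ZMod N) :
    (czGen ω ^ k.val : CZ N) t = rpow ω (t * k) := by
  rw [Pi.pow_apply, czGen, rpow_pow_val hω]

theorem czGen_mem_unitary (hω : IsPrimitiveRoot ω N) : czGen ω ∈ unitary (CZ N) := by
  have h : czGen ω * star (czGen ω) = (1 : CZ N) := by
    funext s
    change rpow ω s * star (rpow ω s) = 1
    rw [star_rpow hω, rpow_mul_neg hω]
  exact Unitary.mem_iff.2 ⟨by rw [mul_comm, h], h⟩

theorem czAction_czGen (hω : IsPrimitiveRoot ω N) (t : ZMod N) :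
    (czAction N).ρ t (czGen ω) = rpow ω t • czGen ω := by
  funext s
  change rpow ω (s + t) = rpow ω t * rpow ω s
  rw [add_comm, rpow_add hω]

theorem czAction_czGen_pow (hω : IsPrimitiveRoot ω N) (t n : ZMod N) :
    (czAction N).ρ t (czGen ω ^ n.val) = rpow ω (t * n) • czGen ω ^ n.val := by
  rw [map_pow, czAction_czGen hω, smul_pow, rpow_pow_val hω]

theorem span_czGen_pow (hω : IsPrimitiveRoot ω N) :
    Submodule.span ℂ (Set.range fun k : ZMod N => (czGen ω ^ k.val : CZ N)) = ⊤ := by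
  have hN : (N : ℂ) ≠ 0 := Nat.cast_ne_zero.2 (NeZero.ne N)
  refine eq_top_iff.2 fun f _ => (Submodule.smul_mem_iff _ hN).1 ?_
  have hf : (N : ℂ) • f =
      ∑ k : ZMod N, (∑ j, rpow ω (k * j) • f (-j)) • (czGen ω ^ k.val : CZ N) := by
    funext t
    have h := sum_rpow_neg_smul_sum_rpow_smul hω (fun j => f (-j)) (-t)
    rw [neg_neg] at h
    rw [Pi.smul_apply, ← h, Finset.sum_apply]
    refine Finset.sum_congr rfl fun k _ => ?_
    rw [Pi.smul_apply, czGen_pow_apply hω, smul_eq_mul, smul_eq_mul, mul_neg, neg_neg, mul_comm,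
      mul_comm k t]
  rw [hf]
  exact Submodule.sum_mem _ fun k _ => Submodule.smul_mem _ _ (Submodule.subset_span ⟨k, rfl⟩)

theorem cz_linearMap_ext (hω : IsPrimitiveRoot ω N) {E : Type*} [AddCommMonoid E] [Module ℂ E]
    {φ ψ : CZ N →ₗ[ℂ] E}
    (h : ∀ k : ZMod N, φ (czGen ω ^ k.val) = ψ (czGen ω ^ k.val)) : φ = ψ :=
  LinearMap.ext_on_range (span_czGen_pow hω) h

theorem cz_hom_ext (hω : IsPrimitiveRoot ω N) {E : Type*} [Ring E] [StarRing E] [Algebra ℂ E]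
    {φ ψ : CZ N →⋆ₐ[ℂ] E} (h : φ (czGen ω) = ψ (czGen ω)) : φ = ψ :=
  StarAlgHom.ext <| LinearMap.congr_fun <| cz_linearMap_ext hω
    (φ := φ.toAlgHom.toLinearMap) (ψ := ψ.toAlgHom.toLinearMap) fun k => by
      change φ (czGen ω ^ k.val) = ψ (czGen ω ^ k.val)
      rw [map_pow, map_pow, h]

variable (hω : IsPrimitiveRoot ω N)
variable {H : Type u} [NormedAddCommGroup H] [InnerProductSpace ℂ H] [CompleteSpace H]
variable {A : Type v} [CStarAlgebra A] {α : ZNAction N A} (R : CovRep α H)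

theorem boson_generated :
    generated ({j₁ hω (czRep N) R (czGen ω)} ∪ Set.range (j₂ hω (czRep N) R)) = ⊤ := by
  set G := generated ({j₁ hω (czRep N) R (czGen ω)} ∪ Set.range (j₂ hω (czRep N) R))
  have hz : j₁ hω (czRep N) R (czGen ω) ∈ G := subset_generated (Or.inl rfl)
  have hj₁ : ⊤ ≤ (G.comap (j₁ hω (czRep N) R)).toSubalgebra.toSubmodule := by
    rw [← span_czGen_pow hω, Submodule.span_le]
    rintro _ ⟨k, rfl⟩
    change j₁ hω (czRep N) R (czGen ω ^ k.val) ∈ G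
    rw [map_pow]
    exact pow_mem hz _
  rw [eq_top_iff, ← generated_j₁_j₂ hω (czRep N) R]
  refine generated_le ?_ (isClosed_generated _)
  rintro _ (⟨f, rfl⟩ | hb)
  exacts [hj₁ Submodule.mem_top, subset_generated (Or.inr hb)]

theorem boson_covPair : CovPair α (j₂ hω (czRep N) R) (j₁ hω (czRep N) R (czGen ω)) :=
  covPair_j₂ hω _ _ (czGen_mem_unitary hω) (czGen_pow_eq_one hω) (czAction_czGen hω)

theorem boson_isCrossedProduct :
    IsCrossedProduct.{_, _, w} α (j₂ hω (czRep N) R) (j₁ hω (czRep N) R (czGen ω)) := by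
  refine isCrossedProduct_of_dual hω (boson_covPair hω R) (j₂_injective hω _ _)
    (boson_generated hω R) (θ := leftAction hω (czRep N) R) (fun t => ?_)
    fun t a => leftAction_j₂ hω _ _ t a
  rw [leftAction_j₁, czAction_czGen hω, map_smul]

end CyclicGroup

section PermRelations

theorem mul_mul_mul_comm_of_mul_eq_smul {B : Type*} [Ring B] [Algebra ℂ B] {u v : B} {c : ℂ}
    (h : v * u = c • (u * v)) (a b : B) : a * v * (u * b) = c • (a * u * (v * b)) := by
  rw [mul_assoc, ← mul_assoc v, h, smul_mul_assoc, mul_smul_comm, mul_assoc, mul_assoc]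

variable {N : ℕ} [NeZero N] {ω : ℂ}
variable {B : Type v} [Ring B] [StarRing B] [Algebra ℂ B] {q x y : ZMod N → ZMod N → B}

theorem PermRel.map {C : Type w} [Ring C] [StarRing C] [Algebra ℂ C] (h : PermRel ω q)
    (Φ : B →⋆ₐ[ℂ] C) : PermRel ω fun i j => Φ (q i j) where
  row_zero i := by rw [h.row_zero, apply_ite Φ, map_one, map_zero]
  col_zero i := by rw [h.col_zero, apply_ite Φ, map_one, map_zero]
  star_eq i j := by rw [← map_star, h.star_eq, map_smul]
  mul_col i j k := by simp only [h.mul_col i j k, map_sum, map_smul, map_mul]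
  mul_row i j k := by simp only [h.mul_row i j k, map_sum, map_smul, map_mul]

theorem PermRel.of_map {C : Type w} [Ring C] [StarRing C] [Algebra ℂ C] {Φ : B →⋆ₐ[ℂ] C}
    (hΦ : Function.Injective Φ) (h : PermRel ω fun i j => Φ (q i j)) : PermRel ω q where
  row_zero i := hΦ (by rw [h.row_zero, apply_ite Φ, map_one, map_zero])
  col_zero i := hΦ (by rw [h.col_zero, apply_ite Φ, map_one, map_zero])
  star_eq i j := hΦ (by rw [map_star, h.star_eq, map_smul])
  mul_col i j k := hΦ (by simp only [h.mul_col i j k, map_sum, map_smul, map_mul])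
  mul_row i j k := hΦ (by simp only [h.mul_row i j k, map_sum, map_smul, map_mul])

theorem PermRel.sum_mul_mul_col (hω : IsPrimitiveRoot ω N) (hx : PermRel ω x) (hy : PermRel ω y)
    (hxy : ∀ i j k l, y k l * x i j = rpow ω (-((j - i) * (l - k))) • (x i j * y k l))
    (i j k : ZMod N) :
    ∑ m, x k m * y m (i + j) = ∑ l, rpow ω (-(l * (i - k + l))) •
      ((∑ r, x (k - l) r * y r i) * ∑ s, x l s * y s j) := by
  calc ∑ m, x k m * y m (i + j)
      = ∑ m, ∑ s, rpow ω (-(s * (i - m + s))) • (x k m * (y (m - s) i * y s j)) := by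
        simp only [hy.mul_col i j, Finset.mul_sum, mul_smul_comm]
    _ = ∑ s, ∑ r, rpow ω (-(s * (i - r))) • (x k (r + s) * (y r i * y s j)) := by
        rw [Finset.sum_comm]
        refine Finset.sum_congr rfl fun s _ => Fintype.sum_equiv (Equiv.subRight s) _ _ fun m => ?_
        rw [Equiv.subRight_apply, sub_add_cancel, sub_sub_eq_add_sub, add_sub_right_comm]
    _ = ∑ s, ∑ r, ∑ l, rpow ω (-(s * (i - r))) • rpow ω (-(l * (r - k + l))) •
          (x (k - l) r * x l s * (y r i * y s j)) := by
        simp only [hx.mul_col _ _ k, Finset.sum_mul, Finset.smul_sum, smul_mul_assoc]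
    _ = ∑ s, ∑ r, ∑ l, rpow ω (-(l * (i - k + l))) •
          (x (k - l) r * y r i * (x l s * y s j)) := by
        refine Finset.sum_congr rfl fun s _ => Finset.sum_congr rfl fun r _ =>
          Finset.sum_congr rfl fun l _ => ?_
        rw [mul_mul_mul_comm_of_mul_eq_smul (hxy _ _ _ _), smul_smul, smul_smul, ← rpow_add hω,
          ← rpow_add hω]
        congr 2
        ring
    _ = _ := by
        simp only [Finset.sum_mul_sum, Finset.smul_sum]
        rw [Finset.sum_comm, Finset.sum_comm_cycle]

theorem PermRel.sum_mul_mul_row (hω : IsPrimitiveRoot ω N) (hx : PermRel ω x) (hy : PermRel ω y)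
    (hxy : ∀ i j k l, y k l * x i j = rpow ω (-((j - i) * (l - k))) • (x i j * y k l))
    (i j k : ZMod N) :
    ∑ m, x (i + j) m * y m k = ∑ s, rpow ω (-(i * (s - j))) •
      ((∑ l, x j l * y l s) * ∑ r, x i r * y r (k - s)) := by
  calc ∑ m, x (i + j) m * y m k
      = ∑ m, ∑ l, rpow ω (-(i * (l - j))) • (x j l * x i (m - l) * y m k) := by
        simp only [hx.mul_row i j, Finset.sum_mul, smul_mul_assoc]
    _ = ∑ l, ∑ r, rpow ω (-(i * (l - j))) • (x j l * x i r * y (r + l) k) := by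
        rw [Finset.sum_comm]
        refine Finset.sum_congr rfl fun l _ => Fintype.sum_equiv (Equiv.subRight l) _ _ fun m => ?_
        rw [Equiv.subRight_apply, sub_add_cancel]
    _ = ∑ l, ∑ r, ∑ s, rpow ω (-(i * (l - j))) • rpow ω (-(r * (s - l))) •
          (x j l * x i r * (y l s * y r (k - s))) := by
        simp only [hy.mul_row _ _ k, Finset.mul_sum, Finset.smul_sum, mul_smul_comm]
    _ = ∑ l, ∑ r, ∑ s, rpow ω (-(i * (s - j))) •
          (x j l * y l s * (x i r * y r (k - s))) := by
        refine Finset.sum_congr rfl fun l _ => Finset.sum_congr rfl fun r _ =>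
          Finset.sum_congr rfl fun s _ => ?_
        rw [mul_mul_mul_comm_of_mul_eq_smul (hxy _ _ _ _), smul_smul, smul_smul, ← rpow_add hω,
          ← rpow_add hω]
        congr 2
        ring
    _ = _ := by
        simp only [Finset.sum_mul_sum, Finset.smul_sum]
        rw [Finset.sum_comm_cycle]

theorem PermRel.sum_mul (hω : IsPrimitiveRoot ω N) (hx : PermRel ω x) (hy : PermRel ω y)
    (hxy : ∀ i j k l, y k l * x i j = rpow ω (-((j - i) * (l - k))) • (x i j * y k l)) :
    PermRel ω fun i j => ∑ k, x i k * y k j where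
  row_zero i := by simp [hx.row_zero, hy.row_zero]
  col_zero i := by simp [hx.col_zero, hy.col_zero]
  star_eq i j := by
    rw [star_sum, Finset.smul_sum]
    refine Fintype.sum_equiv (Equiv.neg _) _ _ fun k => ?_
    rw [star_mul, hx.star_eq, hy.star_eq, smul_mul_smul_comm, hxy, smul_smul, ← rpow_add hω,
      ← rpow_add hω, Equiv.neg_apply]
    congr 2
    ring
  mul_col := hx.sum_mul_mul_col hω hy hxy
  mul_row := hx.sum_mul_mul_row hω hy hxy

end PermRelations

section QuantumPermutationGroup

variable {N : ℕ} [NeZero N] {ω : ℂ}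

theorem cPerm_generated : generated {x : CPerm N ω | ∃ i j, x = CPerm.q ω i j} = ⊤ := by
  set G := generated {x : CPerm N ω | ∃ i j, x = CPerm.q ω i j}
  have hq : PermRel ω fun i j => (⟨CPerm.q ω i j, subset_generated ⟨i, j, rfl⟩⟩ : G) :=
    PermRel.of_map (Φ := G.subtype) Subtype.val_injective (CPerm.rel ω)
  have hid : G.subtype.comp (CPerm.lift hq) = StarAlgHom.id ℂ (CPerm N ω) :=
    CPerm.hom_ext fun i j => congrArg Subtype.val (CPerm.lift_q hq i j)
  refine eq_top_iff.2 fun x _ => ?_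
  have hx : (CPerm.lift hq x : CPerm N ω) = x := DFunLike.congr_fun hid x
  exact hx ▸ (CPerm.lift hq x).2

variable (hω : IsPrimitiveRoot ω N)

theorem BosonRel.covPair {B : Type w} [CStarAlgebra B] {v : B} {q : ZMod N → ZMod N → B}
    (h : BosonRel ω v q) : CovPair (permAction hω) (CPerm.lift h.perm) v := by
  refine .of_generated_eq_top cPerm_generated (Unitary.mem_iff.2 ⟨h.star_mul, h.mul_star⟩)
    h.pow_eq_one ?_
  rintro _ ⟨i, j, rfl⟩
  rw [permAction_q, one_mul, map_smul, CPerm.lift_q, h.comm, smul_mul_assoc]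

variable {L : Type u} [NormedAddCommGroup L] [InnerProductSpace ℂ L] [CompleteSpace L]
variable (R : CovRep (permAction hω) L)

theorem boson_rel : BosonRel ω (bosonZ hω R) (bosonQ hω R) where
  mul_star := Unitary.mul_star_self_of_mem (boson_covPair hω R).mem_unitary
  star_mul := Unitary.star_mul_self_of_mem (boson_covPair hω R).mem_unitary
  pow_eq_one := (boson_covPair hω R).pow_eq_one
  comm i j := by
    rw [bosonZ, bosonQ, (boson_covPair hω R).mul_eq, permAction_q, one_mul, map_smul,
      smul_mul_assoc]
  perm := (CPerm.rel ω).map (j₂ hω (czRep N) R)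

theorem boson_generated_q :
    generated ({bosonZ hω R} ∪ {x | ∃ i j, x = bosonQ hω R i j}) = ⊤ := by
  rw [eq_top_iff, ← boson_generated hω R]
  refine generated_le ?_ (isClosed_generated _)
  rintro _ (rfl | ⟨a, rfl⟩)
  · exact subset_generated (Or.inl rfl)
  · refine map_mem_of_mem_generated (isClosed_generated _) _ ?_
      (cPerm_generated (N := N) (ω := ω) ▸ StarSubalgebra.mem_top)
    rintro _ ⟨i, j, rfl⟩
    exact subset_generated (Or.inr ⟨i, j, rfl⟩)

theorem boson_isUniversal : IsUniversalBoson.{_, w} ω (bosonZ hω R) (bosonQ hω R) where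
  rel := boson_rel hω R
  generates := boson_generated_q hω R
  universal B _ v q h := by
    have hcov := h.covPair hω
    obtain ⟨Φ, ⟨hΦz, hΦι⟩, -⟩ := (boson_isCrossedProduct.{_, _, w} hω R).universal B
      (CPerm.lift h.perm) v hcov.mem_unitary hcov.pow_eq_one hcov.covariant
    have hΦq : ∀ i j, Φ (bosonQ hω R i j) = q i j := fun i j =>
      (DFunLike.congr_fun hΦι (CPerm.q ω i j)).trans (CPerm.lift_q _ _ _)
    refine ⟨Φ, ⟨hΦz, hΦq⟩, ?_⟩
    rintro Ψ ⟨hΨz, hΨq⟩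
    refine hom_ext_of_generated_eq_top (boson_generated_q hω R) ?_
    rintro _ (rfl | ⟨i, j, rfl⟩)
    · exact hΨz.trans hΦz.symm
    · exact (hΨq i j).trans (hΦq i j).symm

theorem permRel_comult : PermRel ω fun i j : ZMod N =>
    ∑ k, j₁ hω R R (CPerm.q ω i k) * j₂ hω R R (CPerm.q ω k j) :=
  ((CPerm.rel ω).map (j₁ hω R R)).sum_mul hω ((CPerm.rel ω).map (j₂ hω R R)) fun i j k l =>
    j₂_mul_j₁ hω R R (fun t => permAction_q hω t i j) fun t => permAction_q hω t k l

theorem existsUnique_permComult :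
    ∃! Δ : CPerm N ω →⋆ₐ[ℂ] BraidedTensor hω R R, IsPermComult hω R Δ :=
  ⟨CPerm.lift (permRel_comult hω R), CPerm.lift_q _, fun _ h =>
    CPerm.hom_ext fun i j => (h i j).trans (CPerm.lift_q (permRel_comult hω R) i j).symm⟩

theorem IsPermComult.equivariant {Δ : CPerm N ω →⋆ₐ[ℂ] BraidedTensor hω R R}
    (h : IsPermComult hω R Δ) (t : ZMod N) (a : CPerm N ω) :
    Δ ((permAction hω).ρ t a) = (braidedAction hω R R).ρ t (Δ a) := by
  have hcomp : Δ.comp ((permAction hω).ρ t) = ((braidedAction hω R R).ρ t).comp Δ :=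
    CPerm.hom_ext fun i j => by
      rw [StarAlgHom.comp_apply, StarAlgHom.comp_apply, permAction_q, map_smul, h i j, map_sum,
        Finset.smul_sum]
      refine Finset.sum_congr rfl fun k _ => ?_
      rw [map_mul, braidedAction_j₁, braidedAction_j₂, permAction_q, permAction_q, map_smul,
        map_smul, smul_mul_smul_comm, ← rpow_add hω]
      congr 2
      ring
  exact DFunLike.congr_fun hcomp a

end QuantumPermutationGroup

section Amplification

variable {X : Type*} [NormedAddCommGroup X] [InnerProductSpace ℂ X]
variable {Y : Type*} [NormedAddCommGroup Y] [InnerProductSpace ℂ Y] [CompleteSpace Y]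
variable {X' : Type*} [NormedAddCommGroup X'] [InnerProductSpace ℂ X'] [CompleteSpace X']
variable {Y' : Type*} [NormedAddCommGroup Y'] [InnerProductSpace ℂ Y'] [CompleteSpace Y']
variable {ι κ : Type*} [Fintype ι] [DecidableEq ι] [Fintype κ] [DecidableEq κ]

open ContinuousLinearMap (adjoint)

theorem adjoint_ins_elem (x x' : X) (y : Y) :
    adjoint (ins x : Y →L[ℂ] HTensor X Y) (elem x' y) = inner ℂ x x' • y := by
  refine ext_inner_left ℂ fun y' => ?_
  rw [ContinuousLinearMap.adjoint_inner_right, ins_apply, inner_elem, inner_smul_right]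

/-- A finite family of isometries `X → Y` with orthogonal ranges that span `Y`, characterized by
the Cuntz relations. It identifies `Y` with a multiple of `X`. -/
structure IsCuntzFamily [CompleteSpace X] (W : ι → X →L[ℂ] Y) : Prop where
  adjoint_comp : ∀ i j, adjoint (W i) ∘L W j = if i = j then .id ℂ X else 0
  sum_comp_adjoint : ∑ i, W i ∘L adjoint (W i) = .id ℂ Y

theorem isCuntzFamily_ins (b : OrthonormalBasis ι ℂ X) :
    IsCuntzFamily fun i => (ins (b i) : Y →L[ℂ] HTensor X Y) where
  adjoint_comp i j := ContinuousLinearMap.ext fun y => by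
    rw [ContinuousLinearMap.comp_apply, ins_apply, adjoint_ins_elem, b.inner_eq_ite]
    split_ifs <;> simp
  sum_comp_adjoint := ext_elem fun x y => by
    simp only [sum_apply, ContinuousLinearMap.comp_apply, adjoint_ins_elem, map_smul, ins_apply,
      ← elem_smul_left, ← elem_sum_left, b.sum_repr', ContinuousLinearMap.id_apply]

variable [CompleteSpace X]

theorem adjoint_opT (S : X →L[ℂ] X') (T : Y →L[ℂ] Y') :
    adjoint (opT S T) = opT (adjoint S) (adjoint T) := by
  refine (eq_adjoint_of_elem fun a b c d => ?_).symm
  rw [opT_elem, opT_elem, inner_elem, inner_elem, ContinuousLinearMap.adjoint_inner_left,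
    ContinuousLinearMap.adjoint_inner_left]

namespace IsCuntzFamily

variable {W : ι → X →L[ℂ] Y} {W' : κ → X' →L[ℂ] Y'}

theorem comp_unitary (h : IsCuntzFamily W) (u : ι → unitary (X →L[ℂ] X)) :
    IsCuntzFamily fun i => W i ∘L (u i : X →L[ℂ] X) where
  adjoint_comp i j := by
    have hassoc : adjoint (W i ∘L (u i : X →L[ℂ] X)) ∘L W j ∘L (u j : X →L[ℂ] X) =
        adjoint (u i : X →L[ℂ] X) ∘L (adjoint (W i) ∘L W j) ∘L (u j : X →L[ℂ] X) := by
      rw [ContinuousLinearMap.adjoint_comp]; rfl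
    rw [hassoc, h.adjoint_comp]
    split_ifs with hij
    · subst hij
      exact Unitary.star_mul_self_of_mem (u i).2
    · simp
  sum_comp_adjoint := by
    rw [← h.sum_comp_adjoint]
    refine Finset.sum_congr rfl fun i _ => ?_
    have hu : (u i : X →L[ℂ] X) ∘L adjoint (u i : X →L[ℂ] X) = .id ℂ X :=
      Unitary.mul_star_self_of_mem (u i).2
    rw [ContinuousLinearMap.adjoint_comp, ContinuousLinearMap.comp_assoc,
      ← ContinuousLinearMap.comp_assoc (u i : X →L[ℂ] X), hu, ContinuousLinearMap.id_comp]

theorem opT (h : IsCuntzFamily W) (h' : IsCuntzFamily W') :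
    IsCuntzFamily fun p : ι × κ => opT (W p.1) (W' p.2) where
  adjoint_comp p p' := by
    rw [adjoint_opT, opT_comp, h.adjoint_comp, h'.adjoint_comp]
    by_cases h₁ : p.1 = p'.1 <;> by_cases h₂ : p.2 = p'.2 <;>
      simp only [h₁, h₂, Prod.ext_iff, if_true, if_false, and_true, and_false, and_self,
        opT_zero_left, opT_zero_right]
    exact opT_one
  sum_comp_adjoint := by
    simp only [adjoint_opT, opT_comp, Fintype.sum_prod_type, ← opT_sum_right, ← opT_sum_left,
      h.sum_comp_adjoint, h'.sum_comp_adjoint]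
    exact opT_one

/-- The amplification `T ↦ ∑ i, W i * T * (W i)⋆` of operators on `X` to operators on `Y`. -/
def amplify (h : IsCuntzFamily W) : (X →L[ℂ] X) →⋆ₐ[ℂ] (Y →L[ℂ] Y) where
  toFun T := ∑ i, W i ∘L T ∘L adjoint (W i)
  map_one' := h.sum_comp_adjoint
  map_mul' S T := by
    have hij : ∀ i j, (W i ∘L S ∘L adjoint (W i)) * (W j ∘L T ∘L adjoint (W j)) =
        if i = j then W i ∘L (S * T) ∘L adjoint (W i) else 0 := fun i j => by
      have hassoc : (W i ∘L S ∘L adjoint (W i)) * (W j ∘L T ∘L adjoint (W j)) =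
          W i ∘L S ∘L (adjoint (W i) ∘L W j) ∘L T ∘L adjoint (W j) := rfl
      rw [hassoc, h.adjoint_comp]
      split_ifs with hij
      · subst hij
        rfl
      · simp
    simp only [Finset.sum_mul_sum, hij, Finset.sum_ite_eq, Finset.mem_univ, if_true]
  map_zero' := by simp
  map_add' S T := by simp [Finset.sum_add_distrib]
  commutes' c := by
    simp only [Algebra.algebraMap_eq_smul_one, ContinuousLinearMap.smul_comp,
      ContinuousLinearMap.comp_smul, ← Finset.smul_sum]
    exact congrArg (c • ·) h.sum_comp_adjoint
  map_star' T := by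
    simp only [star_sum, ContinuousLinearMap.star_eq_adjoint, ContinuousLinearMap.adjoint_comp,
      ContinuousLinearMap.adjoint_adjoint, ContinuousLinearMap.comp_assoc]

theorem amplify_eq (h : IsCuntzFamily W) {T : X →L[ℂ] X} {S : Y →L[ℂ] Y}
    (hST : ∀ i, S ∘L W i = W i ∘L T) : h.amplify T = S := by
  change ∑ i, W i ∘L T ∘L adjoint (W i) = S
  rw [← ContinuousLinearMap.comp_id S, ← h.sum_comp_adjoint, ContinuousLinearMap.comp_finsetSum]
  refine Finset.sum_congr rfl fun i _ => ?_
  rw [← ContinuousLinearMap.comp_assoc, ← ContinuousLinearMap.comp_assoc, hST]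

theorem amplify_opT (h : IsCuntzFamily W) (h' : IsCuntzFamily W') {T : X →L[ℂ] X}
    {S : Y →L[ℂ] Y} {T' : X' →L[ℂ] X'} {S' : Y' →L[ℂ] Y'} (hST : ∀ i, S ∘L W i = W i ∘L T)
    (hST' : ∀ i, S' ∘L W' i = W' i ∘L T') :
    (h.opT h').amplify (Anyonic.opT T T') = Anyonic.opT S S' :=
  amplify_eq _ fun p => by rw [opT_comp, opT_comp, hST, hST']

end IsCuntzFamily

end Amplification

section Corepresentation

section DiagonalSums

variable {X : Type*} [NormedAddCommGroup X] [InnerProductSpace ℂ X]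
variable {Y : Type*} [NormedAddCommGroup Y] [InnerProductSpace ℂ Y]
variable {ι : Type*} [Fintype ι]

theorem sum_opT_mul_sum_opT_left {e : ι → X →L[ℂ] X} (he : OrthogonalIdempotents e)
    (S T : ι → Y →L[ℂ] Y) :
    (∑ i, opT (e i) (S i)) * ∑ i, opT (e i) (T i) = ∑ i, opT (e i) (S i * T i) := by
  classical
  have hite : ∀ i j (Z : Y →L[ℂ] Y), opT (if i = j then e i else 0) Z =
      if i = j then opT (e i) Z else 0 := fun i j Z => by
    split_ifs <;> simp only [opT_zero_left]
  simp only [Finset.sum_mul_sum, opT_mul, he.mul_eq, hite, Finset.sum_ite_eq, Finset.mem_univ,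
    if_true]

theorem sum_opT_mul_sum_opT_right {e : ι → Y →L[ℂ] Y} (he : OrthogonalIdempotents e)
    (S T : ι → X →L[ℂ] X) :
    (∑ i, opT (S i) (e i)) * ∑ i, opT (T i) (e i) = ∑ i, opT (S i * T i) (e i) := by
  classical
  have hite : ∀ i j (Z : X →L[ℂ] X), opT Z (if i = j then e i else 0) =
      if i = j then opT Z (e i) else 0 := fun i j Z => by
    split_ifs <;> simp only [opT_zero_right]
  simp only [Finset.sum_mul_sum, opT_mul, he.mul_eq, hite, Finset.sum_ite_eq, Finset.mem_univ,
    if_true]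

end DiagonalSums

variable {N : ℕ} [NeZero N] {ω : ℂ}
variable {X : Type*} [NormedAddCommGroup X] [InnerProductSpace ℂ X] [CompleteSpace X]
variable {Y : Type*} [NormedAddCommGroup Y] [InnerProductSpace ℂ Y] [CompleteSpace Y]

theorem orthogonalIdempotents_degProj (hω : IsPrimitiveRoot ω N)
    (U : Multiplicative (ZMod N) →* unitary (X →L[ℂ] X)) :
    OrthogonalIdempotents (degProj ω U) :=
  OrthogonalIdempotents.iff_mul_eq.2 fun m n => by
    rw [degProj_mul_degProj hω]
    split_ifs with h <;> simp only [h]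

theorem sum_smul_czDelta (f : CZ N) : ∑ t, f t • czDelta t = f := by
  funext t
  simp [czDelta, Pi.single_apply]

variable (V : Multiplicative (ZMod N) →* unitary (X →L[ℂ] X)) (θ : CZ N →⋆ₐ[ℂ] (Y →L[ℂ] Y))

theorem completeOrthogonalIdempotents_map_czDelta :
    CompleteOrthogonalIdempotents fun t => θ (czDelta t) :=
  (CompleteOrthogonalIdempotents.single fun _ : ZMod N => ℂ).map (θ : CZ N →+* (Y →L[ℂ] Y))

/-- The unitary `∑ t, V t ⊗ θ δ_t`: the corepresentation of `C(ℤ/Nℤ)` attached to the unitary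
representation `V`, with its second leg represented by `θ`. -/
def corep : unitary (HTensor X Y →L[ℂ] HTensor X Y) :=
  ⟨∑ t, opT (V (.ofAdd t) : X →L[ℂ] X) (θ (czDelta t)), by
    have hstar : star (∑ t, opT (V (.ofAdd t) : X →L[ℂ] X) (θ (czDelta t))) =
        ∑ t, opT (star (V (.ofAdd t) : X →L[ℂ] X)) (θ (czDelta t)) := by
      have hδ : ∀ t : ZMod N, star (czDelta t) = czDelta t := fun t => by
        simp [czDelta]
      simp only [star_sum, star_opT, ← map_star, hδ]
    have hθ := completeOrthogonalIdempotents_map_czDelta θ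
    rw [Unitary.mem_iff, hstar, sum_opT_mul_sum_opT_right hθ.toOrthogonalIdempotents,
      sum_opT_mul_sum_opT_right hθ.toOrthogonalIdempotents]
    simp only [Unitary.star_mul_self_of_mem (V _).2, Unitary.mul_star_self_of_mem (V _).2,
      ← opT_sum_right, hθ.complete, opT_one, and_self]⟩

theorem coe_corep : (corep V θ : HTensor X Y →L[ℂ] HTensor X Y) =
    ∑ t, opT (V (.ofAdd t) : X →L[ℂ] X) (θ (czDelta t)) := rfl

theorem coe_corep_eq_sum_degProj (hω : IsPrimitiveRoot ω N) :
    (corep V θ : HTensor X Y →L[ℂ] HTensor X Y) =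
      ∑ n : ZMod N, opT (degProj ω V n) (θ (czGen ω ^ n.val)) := by
  have hz : ∀ n : ZMod N, θ (czGen ω ^ n.val) = ∑ t, rpow ω (t * n) • θ (czDelta t) := fun n => by
    rw [← sum_smul_czDelta (czGen ω ^ n.val), map_sum]
    simp only [map_smul, czGen_pow_apply hω]
  simp only [coe_corep, ← sum_rpow_smul_degProj hω V, hz, opT_sum_left, opT_sum_right,
    opT_smul_left, opT_smul_right]
  exact Finset.sum_comm

variable {V θ}

theorem conj_corep_opT_one {x : X →L[ℂ] X} {y : ZMod N → X →L[ℂ] X}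
    (h : ∀ t, (V (.ofAdd t) : X →L[ℂ] X) * x = y t * (V (.ofAdd t) : X →L[ℂ] X)) :
    conj (corep V θ) (opT x 1) = ∑ t, opT (y t) (θ (czDelta t)) := by
  refine conj_eq_of_mul_eq ?_
  have hθ := (completeOrthogonalIdempotents_map_czDelta θ).toOrthogonalIdempotents
  simp only [coe_corep, sum_opT_mul_sum_opT_right hθ, ← h, Finset.sum_mul, opT_mul, mul_one]

theorem conj_corep_sum_opT_degProj (hω : IsPrimitiveRoot ω N) {x : ZMod N → Y →L[ℂ] Y}
    {y : Y →L[ℂ] Y}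
    (h : ∀ n : ZMod N, θ (czGen ω ^ n.val) * x n = y * θ (czGen ω ^ n.val)) :
    conj (corep V θ) (∑ n, opT (degProj ω V n) (x n)) = opT 1 y := by
  refine conj_eq_of_mul_eq ?_
  have hV := orthogonalIdempotents_degProj hω V
  rw [coe_corep_eq_sum_degProj V θ hω, sum_opT_mul_sum_opT_left hV]
  simp only [h, Finset.mul_sum, opT_mul, one_mul]

end Corepresentation

section Characters

variable {N : ℕ} [NeZero N] {ω : ℂ}

/-- The normalized character `r ↦ ω ^ (r * m) / √N`, which spans the vectors of degree `m` in
`ℓ²(ℤ/Nℤ)`. -/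
def charVec (ω : ℂ) (m : ZMod N) : EuclideanSpace ℂ (ZMod N) :=
  WithLp.toLp 2 fun r => (√N : ℂ)⁻¹ * rpow ω (r * m)

theorem hasDegree_charVec (hω : IsPrimitiveRoot ω N) (m : ZMod N) :
    HasDegree ω (czU N) m (charVec ω m) := fun t => by
  ext r
  change (√N : ℂ)⁻¹ * rpow ω ((r + t) * m) = rpow ω (t * m) * ((√N : ℂ)⁻¹ * rpow ω (r * m))
  rw [add_mul, add_comm, rpow_add hω, mul_left_comm]

theorem orthonormal_charVec (hω : IsPrimitiveRoot ω N) :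
    Orthonormal ℂ (charVec ω : ZMod N → EuclideanSpace ℂ (ZMod N)) := by
  refine orthonormal_iff_ite.2 fun m n => ?_
  have hsq : (√N : ℂ)⁻¹ * (√N : ℂ)⁻¹ = (N : ℂ)⁻¹ := by
    rw [← mul_inv, ← Complex.ofReal_mul, Real.mul_self_sqrt (Nat.cast_nonneg N),
      Complex.ofReal_natCast]
  have hterm : ∀ r : ZMod N, inner ℂ (charVec ω m r) (charVec ω n r) =
      (N : ℂ)⁻¹ * rpow ω (r * (n - m)) := fun r => by
    have hconj : (starRingEnd ℂ) (rpow ω (r * m)) = rpow ω (-(r * m)) := star_rpow hω _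
    rw [charVec, charVec, RCLike.inner_apply, map_mul, hconj, map_inv₀, Complex.conj_ofReal,
      mul_mul_mul_comm, hsq, ← rpow_add hω, mul_sub, sub_eq_add_neg]
  rw [PiLp.inner_apply, Finset.sum_congr rfl fun r _ => hterm r, ← Finset.mul_sum, sum_rpow hω]
  have hN : (N : ℂ) ≠ 0 := Nat.cast_ne_zero.2 (NeZero.ne N)
  simp only [sub_eq_zero, eq_comm (a := n), mul_ite, inv_mul_cancel₀ hN, mul_zero]

/-- The orthonormal basis of characters of `ℓ²(ℤ/Nℤ)`, which diagonalizes translations. -/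
def charBasis (hω : IsPrimitiveRoot ω N) :
    OrthonormalBasis (ZMod N) ℂ (EuclideanSpace ℂ (ZMod N)) :=
  .mk (orthonormal_charVec hω)
    ((orthonormal_charVec hω).linearIndependent.span_eq_top_of_card_eq_finrank'
      finrank_euclideanSpace.symm).ge

theorem hasDegree_charBasis (hω : IsPrimitiveRoot ω N) (m : ZMod N) :
    HasDegree ω (czU N) m (charBasis hω m) := by
  rw [charBasis, OrthonormalBasis.coe_mk]
  exact hasDegree_charVec hω m

variable {H : Type u} [NormedAddCommGroup H] [InnerProductSpace ℂ H] [CompleteSpace H]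

/-- The isometry `x ↦ χ_m ⊗ U_{-m} x`, where `χ_m` is the normalized character of degree `m`. The
twist by `U_{-m}` undoes the braiding of `χ_m` with the second tensor factor. -/
def charIsom (hω : IsPrimitiveRoot ω N) (U : Multiplicative (ZMod N) →* unitary (H →L[ℂ] H))
    (m : ZMod N) : H →L[ℂ] HTensor (EuclideanSpace ℂ (ZMod N)) H :=
  ins (charBasis hω m) ∘L (U (.ofAdd (-m)) : H →L[ℂ] H)

theorem isCuntzFamily_charIsom (hω : IsPrimitiveRoot ω N)
    (U : Multiplicative (ZMod N) →* unitary (H →L[ℂ] H)) : IsCuntzFamily (charIsom hω U) :=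
  (isCuntzFamily_ins (charBasis hω)).comp_unitary fun m => U (.ofAdd (-m))

theorem opT_one_degProj_comp_charIsom (hω : IsPrimitiveRoot ω N)
    (U : Multiplicative (ZMod N) →* unitary (H →L[ℂ] H)) (n m : ZMod N) :
    opT 1 (degProj ω U n) ∘L charIsom hω U m = charIsom hω U m ∘L degProj ω U n :=
  ContinuousLinearMap.ext fun x => by
    simp only [charIsom, ContinuousLinearMap.comp_apply, ins_apply, opT_elem, degProj_U,
      one_apply_eq_self]

variable {A : Type*} [CStarAlgebra A] {α : ZNAction N A}

theorem leg2_comp_charIsom (hω : IsPrimitiveRoot ω N) (R : CovRep α H) (a : A) (m : ZMod N) :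
    leg2 hω (czRep N) R a ∘L charIsom hω R.U m = charIsom hω R.U m ∘L R.π a :=
  ContinuousLinearMap.ext fun x => by
    have hU : R.π (α.ρ (-m) a) ((R.U (.ofAdd (-m)) : H →L[ℂ] H) x) =
        (R.U (.ofAdd (-m)) : H →L[ℂ] H) (R.π a x) :=
      (DFunLike.congr_fun (R.U_mul_π (-m) a) x).symm
    have hm : HasDegree ω (czRep N).U m (charBasis hω m) := hasDegree_charBasis hω m
    simp only [charIsom, ContinuousLinearMap.comp_apply, ins_apply, leg2_elem hω _ R hm, hU]

end Characters

section PsiOperator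

variable {N : ℕ} [NeZero N] {ω : ℂ} (hω : IsPrimitiveRoot ω N)
variable {H : Type u} [NormedAddCommGroup H] [InnerProductSpace ℂ H] [CompleteSpace H]
variable {K : Type v} [NormedAddCommGroup K] [InnerProductSpace ℂ K] [CompleteSpace K]
variable {A : Type*} [CStarAlgebra A] {α : ZNAction N A}
variable {B : Type*} [CStarAlgebra B] {β : ZNAction N B}

theorem degProj_tensorU_one (U : Multiplicative (ZMod N) →* unitary (K →L[ℂ] K)) (n : ZMod N) :
    degProj ω (tensorU (1 : _ →* unitary (H →L[ℂ] H)) U) n = opT 1 (degProj ω U n) := by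
  simp only [degProj, opT_smul_right, opT_sum_right]
  rfl

variable (R : CovRep α H) (S : CovRep β K)

/-- The restriction of `ψ` to the last two factors, extended to all operators: amplify both legs
along the characters, then conjugate by the corepresentation `∑ t, (1 ⊗ U_t) ⊗ (δ_t ⊗ 1)`. -/
def psiOp : (HTensor H K →L[ℂ] HTensor H K) →⋆ₐ[ℂ]
    (HTensor (HTensor (EuclideanSpace ℂ (ZMod N)) H) (HTensor (EuclideanSpace ℂ (ZMod N)) K) →L[ℂ]
      HTensor (HTensor (EuclideanSpace ℂ (ZMod N)) H) (HTensor (EuclideanSpace ℂ (ZMod N)) K)) :=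
  (conj (corep (tensorU 1 R.U) (leg1 (czRep N)))).comp
    ((isCuntzFamily_charIsom hω R.U).opT (isCuntzFamily_charIsom hω S.U)).amplify

theorem psiOp_leg1 (a : A) : psiOp hω R S (leg1 R a) =
    ∑ t : ZMod N, opT (leg2 hω (czRep N) R (α.ρ t a)) (leg1 (K := K) (czRep N) (czDelta t)) := by
  have hamp : ((isCuntzFamily_charIsom hω R.U).opT (isCuntzFamily_charIsom hω S.U)).amplify
      (leg1 R a) = opT (leg2 hω (czRep N) R a) 1 :=
    (isCuntzFamily_charIsom hω R.U).amplify_opT (isCuntzFamily_charIsom hω S.U)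
      (leg2_comp_charIsom hω R a) fun _ => rfl
  rw [psiOp, StarAlgHom.comp_apply, hamp]
  exact conj_corep_opT_one fun t => opT_one_U_mul_leg2 hω (czRep N) R t a

theorem psiOp_leg2 (b : B) : psiOp hω R S (leg2 hω R S b) = opT 1 (leg2 hω (czRep N) S b) := by
  have hamp : ((isCuntzFamily_charIsom hω R.U).opT (isCuntzFamily_charIsom hω S.U)).amplify
      (leg2 hω R S b) = ∑ n, opT (degProj ω (tensorU 1 R.U) n)
        (leg2 hω (czRep N) S (β.ρ (-n) b)) := by
    rw [leg2_apply, map_sum]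
    refine Finset.sum_congr rfl fun n _ => ?_
    rw [degProj_tensorU_one]
    exact (isCuntzFamily_charIsom hω R.U).amplify_opT (isCuntzFamily_charIsom hω S.U)
      (opT_one_degProj_comp_charIsom hω R.U n)
      (leg2_comp_charIsom hω S (β.ρ (-n) b))
  rw [psiOp, StarAlgHom.comp_apply, hamp]
  refine conj_corep_sum_opT_degProj hω fun n => ?_
  rw [leg1_mul_leg2 hω (czRep N) S (fun t => czAction_czGen_pow hω t n), ← β.ρ_add,
    add_neg_cancel, β.ρ_zero]

end PsiOperator

section MinimalTensor

variable {H : Type u} [NormedAddCommGroup H] [InnerProductSpace ℂ H] [CompleteSpace H]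
variable {K : Type v} [NormedAddCommGroup K] [InnerProductSpace ℂ K] [CompleteSpace K]
variable {N : ℕ} {A : Type*} [CStarAlgebra A] {α : ZNAction N A}
variable {B : Type*} [CStarAlgebra B] {β : ZNAction N B}
variable (R : CovRep α H) (S : CovRep β K)

theorem minTmul_mul (a a' : A) (b b' : B) :
    minTmul R S a b * minTmul R S a' b' = minTmul R S (a * a') (b * b') :=
  Subtype.ext <| by
    change opT (R.π a) (S.π b) * opT (R.π a') (S.π b') = opT (R.π (a * a')) (S.π (b * b'))
    rw [opT_mul, map_mul, map_mul]

theorem star_minTmul (a : A) (b : B) : star (minTmul R S a b) = minTmul R S (star a) (star b) :=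
  Subtype.ext <| by
    change star (opT (R.π a) (S.π b)) = opT (R.π (star a)) (S.π (star b))
    rw [star_opT, map_star, map_star]

theorem minTmul_one : minTmul R S 1 1 = 1 :=
  Subtype.ext <| by
    change opT (R.π 1) (S.π 1) = 1
    rw [map_one, map_one, opT_one]

theorem minTmul_pow (a : A) (b : B) (n : ℕ) :
    minTmul R S a b ^ n = minTmul R S (a ^ n) (b ^ n) := by
  induction n with
  | zero => rw [pow_zero, pow_zero, pow_zero, minTmul_one]
  | succ n ih => rw [pow_succ, ih, minTmul_mul, pow_succ, pow_succ]

variable {R S} in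
theorem minTmul_mem_unitary {a : A} {b : B} (ha : a ∈ unitary A) (hb : b ∈ unitary B) :
    minTmul R S a b ∈ unitary (MinTensor R S) := by
  rw [Unitary.mem_iff, star_minTmul, minTmul_mul, minTmul_mul, Unitary.star_mul_self_of_mem ha,
    Unitary.star_mul_self_of_mem hb, Unitary.mul_star_self_of_mem ha,
    Unitary.mul_star_self_of_mem hb, minTmul_one]
  exact ⟨rfl, rfl⟩

/-- The elementary tensor `minTmul` as a bilinear map. -/
def minTmulBilin : A →ₗ[ℂ] B →ₗ[ℂ] MinTensor R S :=
  LinearMap.mk₂ ℂ (minTmul R S)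
    (fun a a' b => Subtype.ext <|
      (congrArg (opT · (S.π b)) (map_add R.π a a')).trans (opT_add_left _ _ _))
    (fun c a b => Subtype.ext <|
      (congrArg (opT · (S.π b)) (map_smul R.π c a)).trans (opT_smul_left _ _ _))
    (fun a b b' => Subtype.ext <|
      (congrArg (opT (R.π a)) (map_add S.π b b')).trans (opT_add_right _ _ _))
    (fun c a b => Subtype.ext <|
      (congrArg (opT (R.π a)) (map_smul S.π c b)).trans (opT_smul_right _ _ _))

theorem minTmul_smul_left (c : ℂ) (a : A) (b : B) :
    minTmul R S (c • a) b = c • minTmul R S a b :=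
  (minTmulBilin R S).map_smul₂ c a b

theorem minTmul_smul_right (c : ℂ) (a : A) (b : B) :
    minTmul R S a (c • b) = c • minTmul R S a b :=
  (minTmulBilin R S a).map_smul c b

theorem minTmul_sum_left {ι : Type*} (s : Finset ι) (a : ι → A) (b : B) :
    minTmul R S (∑ i ∈ s, a i) b = ∑ i ∈ s, minTmul R S (a i) b :=
  (minTmulBilin R S).map_sum₂ s a b

theorem minTmul_sum_right {ι : Type*} (s : Finset ι) (a : A) (b : ι → B) :
    minTmul R S a (∑ i ∈ s, b i) = ∑ i ∈ s, minTmul R S a (b i) :=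
  map_sum (minTmulBilin R S a) b s

theorem coe_sum_minTensor {ι : Type*} (s : Finset ι) (x : ι → MinTensor R S) :
    (∑ i ∈ s, x i : MinTensor R S).1 = ∑ i ∈ s, (x i).1 :=
  map_sum ((minSubalgebra R S).subtype : ↥(minSubalgebra R S) →⋆ₐ[ℂ] _) x s

end MinimalTensor

section Psi

variable {N : ℕ} [NeZero N] {ω : ℂ} (hω : IsPrimitiveRoot ω N)
variable {H : Type u} [NormedAddCommGroup H] [InnerProductSpace ℂ H] [CompleteSpace H]
variable {K : Type v} [NormedAddCommGroup K] [InnerProductSpace ℂ K] [CompleteSpace K]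
variable {A : Type*} [CStarAlgebra A] {α : ZNAction N A}
variable {B : Type*} [CStarAlgebra B] {β : ZNAction N B}
variable (R : CovRep α H) (S : CovRep β K)

theorem psiOp_mem {T : HTensor H K →L[ℂ] HTensor H K} (hT : T ∈ braided hω R S) :
    psiOp hω R S T ∈ minSubalgebra (braidedRep hω (czRep N) R) (braidedRep hω (czRep N) S) := by
  refine map_mem_of_mem_generated (isClosed_generated _) (psiOp hω R S) ?_ hT
  rintro _ ⟨a, b, rfl⟩
  rw [map_mul, psiOp_leg1, psiOp_leg2]
  refine mul_mem (sum_mem fun t _ => ?_) ?_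
  · exact (minTmul (braidedRep hω (czRep N) R) (braidedRep hω (czRep N) S)
      (j₂ hω (czRep N) R (α.ρ t a)) (j₁ hω (czRep N) S (czDelta t))).2
  · exact (minTmul (braidedRep hω (czRep N) R) (braidedRep hω (czRep N) S)
      1 (j₂ hω (czRep N) S b)).2

/-- The restriction of `ψ` to the last two factors. -/
def psiRestrict : BraidedTensor hω R S →⋆ₐ[ℂ]
    MinTensor (braidedRep hω (czRep N) R) (braidedRep hω (czRep N) S) :=
  ((psiOp hω R S).comp (braidedRep hω R S).π).codRestrict
    (minSubalgebra (braidedRep hω (czRep N) R) (braidedRep hω (czRep N) S))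
    fun T => psiOp_mem hω R S T.2

theorem psiRestrict_j₁ (a : A) : psiRestrict hω R S (j₁ hω R S a) =
    ∑ t : ZMod N, minTmul _ _ (j₂ hω (czRep N) R (α.ρ t a)) (j₁ hω (czRep N) S (czDelta t)) :=
  Subtype.ext <| by
    rw [coe_sum_minTensor]
    exact psiOp_leg1 hω R S a

theorem psiRestrict_j₂ (b : B) : psiRestrict hω R S (j₂ hω R S b) =
    minTmul _ _ 1 (j₂ hω (czRep N) S b) :=
  Subtype.ext (psiOp_leg2 hω R S b)

theorem psiRestrict_covPair : CovPair (braidedAction hω R S) (psiRestrict hω R S)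
    (minTmul _ _ (j₁ hω (czRep N) R (czGen ω)) (j₁ hω (czRep N) S (czGen ω))) := by
  have hR := boson_covPair hω R
  have hS := boson_covPair hω S
  refine .of_generated_eq_top (generated_j₁_j₂ hω R S)
    (minTmul_mem_unitary hR.mem_unitary hS.mem_unitary) ?_ ?_
  · rw [minTmul_pow, hR.pow_eq_one, hS.pow_eq_one, minTmul_one]
  · rintro _ (⟨a, rfl⟩ | ⟨b, rfl⟩)
    · have hδ : ∀ t : ZMod N, j₁ hω (czRep N) S (czGen ω) * j₁ hω (czRep N) S (czDelta t) =
          j₁ hω (czRep N) S (czDelta t) * j₁ hω (czRep N) S (czGen ω) := fun t => by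
        rw [← map_mul, mul_comm, map_mul]
      rw [braidedAction_j₁, psiRestrict_j₁, psiRestrict_j₁, Finset.mul_sum, Finset.sum_mul]
      refine Finset.sum_congr rfl fun t _ => ?_
      rw [minTmul_mul, minTmul_mul, hR.mul_eq, hδ, ← α.ρ_add, ← α.ρ_add, add_comm]
    · rw [braidedAction_j₂, psiRestrict_j₂, psiRestrict_j₂, minTmul_mul, minTmul_mul, hS.mul_eq,
        mul_one, one_mul]

/-- The linear map `(j₁ ⊗ j₁) ∘ Δ` on `C(ℤ/Nℤ)`, where `Δ f (s, t) = f (s + t)`. -/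
def comultZ : CZ N →ₗ[ℂ] MinTensor (braidedRep hω (czRep N) R) (braidedRep hω (czRep N) S) where
  toFun f := ∑ s : ZMod N, ∑ t : ZMod N,
    f (s + t) • minTmul _ _ (j₁ hω (czRep N) R (czDelta s)) (j₁ hω (czRep N) S (czDelta t))
  map_add' f g := by simp [add_smul, Finset.sum_add_distrib]
  map_smul' c f := by simp [Finset.smul_sum, mul_smul]

theorem comultZ_czGen_pow (k : ZMod N) : comultZ hω R S (czGen ω ^ k.val) =
    minTmul _ _ (j₁ hω (czRep N) R (czGen ω)) (j₁ hω (czRep N) S (czGen ω)) ^ k.val := by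
  rw [minTmul_pow, ← map_pow, ← map_pow]
  conv_rhs => rw [← sum_smul_czDelta (czGen ω ^ k.val), map_sum, map_sum, minTmul_sum_left]
  refine Finset.sum_congr rfl fun s _ => ?_
  rw [minTmul_sum_right]
  refine Finset.sum_congr rfl fun t _ => ?_
  rw [map_smul, map_smul, minTmul_smul_left, minTmul_smul_right, smul_smul,
    czGen_pow_apply hω, czGen_pow_apply hω, czGen_pow_apply hω, ← rpow_add hω, add_mul]

theorem exists_isPsi : ∃ ψ, IsPsi hω R S ψ := by
  have hcov := psiRestrict_covPair hω R S
  obtain ⟨ψ, ⟨hψz, hψ⟩, -⟩ := (boson_isCrossedProduct hω (braidedRep hω R S)).universal _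
    (psiRestrict hω R S) _ hcov.mem_unitary hcov.pow_eq_one hcov.covariant
  have hψ₁ : ψ.toAlgHom.toLinearMap ∘ₗ
      (j₁ hω (czRep N) (braidedRep hω R S)).toAlgHom.toLinearMap = comultZ hω R S :=
    cz_linearMap_ext hω fun k => by
      rw [comultZ_czGen_pow, ← hψz, ← map_pow, ← map_pow]
      rfl
  exact ⟨ψ, LinearMap.congr_fun hψ₁,
    fun a => (DFunLike.congr_fun hψ _).trans (psiRestrict_j₁ hω R S a),
    fun b => (DFunLike.congr_fun hψ _).trans (psiRestrict_j₂ hω R S b)⟩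

theorem IsPsi.map_czGen {R : CovRep α H} {S : CovRep β K}
    {ψ : BraidedTensor hω (czRep N) (braidedRep hω R S) →⋆ₐ[ℂ]
      MinTensor (braidedRep hω (czRep N) R) (braidedRep hω (czRep N) S)}
    (h : IsPsi hω R S ψ) : ψ (j₁ hω (czRep N) (braidedRep hω R S) (czGen ω)) =
      minTmul _ _ (j₁ hω (czRep N) R (czGen ω)) (j₁ hω (czRep N) S (czGen ω)) := by
  have hpow := comultZ_czGen_pow hω R S 1
  rw [pow_val_one (czGen_pow_eq_one hω), pow_val_one (psiRestrict_covPair hω R S).pow_eq_one]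
    at hpow
  exact (h.1 _).trans hpow

end Psi

section Bosonization

variable {N : ℕ} [NeZero N] {ω : ℂ} (hω : IsPrimitiveRoot ω N)
variable {L : Type u} [NormedAddCommGroup L] [InnerProductSpace ℂ L] [CompleteSpace L]
variable {R : CovRep (permAction hω) L} {Δ : CPerm N ω →⋆ₐ[ℂ] BraidedTensor hω R R}

theorem exists_id_boxtimes (h : IsPermComult hω R Δ) :
    ∃ idΔ : Boson hω R →⋆ₐ[ℂ] BraidedTensor hω (czRep N) (braidedRep hω R R),
      ∀ (f : CZ N) (a : CPerm N ω), idΔ (j₁ hω (czRep N) R f * j₂ hω (czRep N) R a) =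
        j₁ hω (czRep N) (braidedRep hω R R) f * j₂ hω (czRep N) (braidedRep hω R R) (Δ a) := by
  have hcov := boson_covPair hω (braidedRep hω R R)
  obtain ⟨Φ, ⟨hΦz, hΦ⟩, -⟩ := (boson_isCrossedProduct hω R).universal _
    ((j₂ hω (czRep N) (braidedRep hω R R)).comp Δ) _ hcov.mem_unitary hcov.pow_eq_one fun a => by
      rw [StarAlgHom.comp_apply, hcov.covariant, StarAlgHom.comp_apply, h.equivariant]
  have hΦ₁ : Φ.comp (j₁ hω (czRep N) R) = j₁ hω (czRep N) (braidedRep hω R R) :=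
    cz_hom_ext hω hΦz
  exact ⟨Φ, fun f a => (map_mul Φ _ _).trans <|
    congrArg₂ _ (DFunLike.congr_fun hΦ₁ f) (DFunLike.congr_fun hΦ a)⟩

namespace IsBosonComult

variable {D : Boson hω R →⋆ₐ[ℂ] BosonSq hω R}

theorem map_bosonZ (hD : IsBosonComult hω R Δ D) :
    D (bosonZ hω R) = bosonTmul hω R (bosonZ hω R) (bosonZ hω R) := by
  obtain ⟨idΔ, ψ, hid, hψ, rfl⟩ := hD
  have hz := hid (czGen ω) 1
  rw [map_one, map_one, map_one, mul_one, mul_one] at hz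
  rw [StarAlgHom.comp_apply, bosonZ, hz, hψ.map_czGen]
  rfl

theorem map_bosonQ (hΔ : IsPermComult hω R Δ) (hD : IsBosonComult hω R Δ D) (i j : ZMod N) :
    D (bosonQ hω R i j) = ∑ k : ZMod N, bosonTmul hω R (bosonQ hω R i k)
      (bosonZ hω R ^ (k - i).val * bosonQ hω R k j) := by
  obtain ⟨idΔ, ψ, hid, ⟨-, hψ₁, hψ₂⟩, rfl⟩ := hD
  have hq := hid 1 (CPerm.q ω i j)
  rw [map_one, map_one, one_mul, one_mul] at hq
  rw [StarAlgHom.comp_apply, bosonQ, hq, hΔ i j, map_sum, map_sum]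
  refine Finset.sum_congr rfl fun k _ => ?_
  rw [map_mul, map_mul, hψ₁, hψ₂, bosonZ, ← map_pow, ← sum_smul_czDelta (czGen ω ^ (k - i).val),
    map_sum, Finset.sum_mul, Finset.sum_mul, bosonTmul, minTmul_sum_right]
  refine Finset.sum_congr rfl fun t _ => ?_
  rw [minTmul_mul, mul_one, permAction_q, map_smul, minTmul_smul_left, map_smul, smul_mul_assoc,
    minTmul_smul_right, czGen_pow_apply hω]
  rfl

end IsBosonComult

theorem existsUnique_bosonComult (hΔ : IsPermComult hω R Δ) :
    ∃! D : Boson hω R →⋆ₐ[ℂ] BosonSq hω R, IsBosonComult hω R Δ D := by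
  obtain ⟨idΔ, hid⟩ := exists_id_boxtimes hω hΔ
  obtain ⟨ψ, hψ⟩ := exists_isPsi hω R R
  have hD : IsBosonComult hω R Δ (ψ.comp idΔ) := ⟨idΔ, ψ, hid, hψ, rfl⟩
  refine ⟨_, hD, fun D' hD' => hom_ext_of_generated_eq_top (boson_generated_q hω R) ?_⟩
  rintro _ (rfl | ⟨i, j, rfl⟩)
  · rw [hD'.map_bosonZ, hD.map_bosonZ]
  · rw [hD'.map_bosonQ hω hΔ, hD.map_bosonQ hω hΔ]

end Bosonization

end

end Anyonic

theorem theorem3 (N : ℕ) [NeZero N] (ω : ℂ) (hω : IsPrimitiveRoot ω N)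
    (L : Type u) [NormedAddCommGroup L] [InnerProductSpace ℂ L] [CompleteSpace L]
    (R : CovRep (permAction hω) L) :
    IsUniversalBoson.{_, w} ω (bosonZ hω R) (bosonQ hω R) ∧
    IsCrossedProduct.{_, _, w} (permAction hω) (j₂ hω (czRep N) R) (bosonZ hω R) ∧
    (∃! Δ : CPerm N ω →⋆ₐ[ℂ] BraidedTensor hω R R, IsPermComult hω R Δ) ∧
    (∀ Δ : CPerm N ω →⋆ₐ[ℂ] BraidedTensor hω R R, IsPermComult hω R Δ →
      (∃! D : Boson hω R →⋆ₐ[ℂ] BosonSq hω R, IsBosonComult hω R Δ D) ∧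
      ∀ D : Boson hω R →⋆ₐ[ℂ] BosonSq hω R, IsBosonComult hω R Δ D →
        D (bosonZ hω R) = bosonTmul hω R (bosonZ hω R) (bosonZ hω R) ∧
        ∀ i j : ZMod N, D (bosonQ hω R i j) =
          ∑ k : ZMod N, bosonTmul hω R (bosonQ hω R i k)
            (bosonZ hω R ^ (k - i).val * bosonQ hω R k j)) :=
  ⟨boson_isUniversal hω R, boson_isCrossedProduct hω R, existsUnique_permComult hω R,
    fun _ hΔ => ⟨existsUnique_bosonComult hω hΔ,
      fun _ hD => ⟨hD.map_bosonZ, hD.map_bosonQ hω hΔ⟩⟩⟩
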